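/- Let $(R,\mathfrak m)$ be a (Noetherian) Cohen–Macaulay local ring of dimension one possessing a canonical module $\mathrm K_R$, let $I\subsetneq R$ be a canonical ideal of $R$ (i.e. $I\cong \mathrm K_R$ as an $R$-module), and assume that $I$ contains a parameter ideal $Q=(a)$ as a reduction (i.e. $Q\subseteq I$ and $I^{n+1}=QI^n$ for some $n\ge 0$). Let $K=\frac Ia=\{\frac xa\mid x\in I\}$ in the total ring of fractions $\mathrm Q(R)$ of $R$, let $S=R[K]$ and $\mathfrak c=R:S$; all colons are taken in $\mathrm Q(R)$. Let $\mathcal T=R[Qt]$ and $\mathcal R=R[It]$ be the Rees algebras, let $\mathcal S_Q(I)=I\mathcal R/I\mathcal T$ be the Sally module of $I$ with respect to $Q$, and let $\mathrm{rank}\,\mathcal S_Q(I)=\ell_{\mathcal T_{\mathfrak p}}\bigl(\mathcal S_Q(I)_{\mathfrak p}\bigr)$, where $\mathfrak p=\mathfrak m\mathcal T$. Write $\ell_R$ for length, $\mu_R$ for the minimal number of generators, and $r=\ell_R(\mathrm{Ext}^1_R(R/\mathfrak m,R))$ for the Cohen–Macaulay type of $R$. Suppose that $R$ is a 2-almost Gorenstein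 local (2-AGL) ring, i.e. $\mathrm{rank}\,\mathcal S_Q(I)=2$. Then the following hold. (1) $\mathfrak c=K:S=R:K$. (2) $\ell_R(R/\mathfrak c)=2$, and there is a minimal system $x_1,x_2,\dots,x_n$ of generators of $\mathfrak m$ such that $\mathfrak c=(x_1^2)+(x_2,x_3,\dots,x_n)$. (3) $S/K\cong R/\mathfrak c$ and $S/R\cong K/R\oplus R/\mathfrak c$ as $R/\mathfrak c$-modules. (4) $K/R\cong (R/\mathfrak c)^{\oplus \ell}\oplus(R/\mathfrak m)^{\oplus m}$ as an $R/\mathfrak c$-module for some integers $\ell>0$ and $m\ge 0$ such that $\ell+m=r-1$, and $\ell_R(K/R)=2\ell+m$. In particular, $K/R$ is a free $R/\mathfrak c$-module if and only if $\ell_R(K/R)=2(r-1)$. (5) $S$ is a finitely generated $R$-module, $\mu_R(S/R)=r$, and $\mu_R(S)=r+1$. -/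

import Mathlib

universe u v

namespace TwoAGL

noncomputable section

open Polynomial IsLocalRing

/-! ### Cohen–Macaulay modules, type, canonical modules -/

section Canonical

variable (R : Type u) [CommRing R] [IsLocalRing R]

/-- `M` is a maximal Cohen–Macaulay module over the local ring `R`: it is finitely generated and
the maximal ideal contains an `M`-regular sequence of length `dim R`
(`IsRegular` includes `M ≠ 0`). -/
def IsMaximalCohenMacaulay (M : Type*) [AddCommGroup M] [Module R M] : Prop :=
  Module.Finite R M ∧ ∃ rs : List R, (∀ x ∈ rs, x ∈ maximalIdeal R) ∧
    RingTheory.Sequence.IsRegular M rs ∧ (rs.length : WithBot ℕ∞) = ringKrullDim R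

/-- The Cohen–Macaulay type `ℓ_R(Ext¹_R(R/𝔪, M))` of a maximal Cohen–Macaulay module `M` over a
local ring `R` of dimension one. -/
def cmType (M : Type u) [AddCommGroup M] [Module R M] : ℕ∞ :=
  Module.length R (CategoryTheory.Abelian.Ext.{u} (ModuleCat.of R (R ⧸ maximalIdeal R))
    (ModuleCat.of R M) 1)

/-- `C` is a canonical module of the Cohen–Macaulay local ring `R` of dimension one: a maximal
Cohen–Macaulay module of type one and of finite injective dimension. -/
structure IsCanonicalModule (C : Type u) [AddCommGroup C] [Module R C] : Prop where
  isMaximalCohenMacaulay : IsMaximalCohenMacaulay R C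
  cmType_eq_one : cmType R C = 1
  finite_injectiveDimension :
    ∃ n : ℕ, CategoryTheory.HasInjectiveDimensionLE (ModuleCat.of R C) n

variable {R}

/-- A canonical ideal: a proper ideal which, as a module, is a canonical module of `R`. -/
def IsCanonicalIdeal (I : Ideal R) : Prop := I ≠ ⊤ ∧ IsCanonicalModule R I

/-- `(a)` is a parameter ideal of the local ring `R` (of dimension one), i.e. `(a)` is
`𝔪`-primary. -/
def IsParameter (a : R) : Prop := (Ideal.span {a}).radical = maximalIdeal R

end Canonical

/-! ### Reductions, Rees algebras and the Sally module -/

section Sally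

variable {R : Type u} [CommRing R]

/-- `J` is a reduction of `I`. -/
def IsReduction (J I : Ideal R) : Prop := J ≤ I ∧ ∃ n : ℕ, I ^ (n + 1) = J * I ^ n

/-- The Rees algebra `𝒯 = R[Qt] ⊆ R[t]` of the principal ideal `Q = (a)`, as a ring. -/
def ReesQ (a : R) : Type u := reesAlgebra (Ideal.span {a})

instance (a : R) : CommRing (ReesQ a) := inferInstanceAs (CommRing (reesAlgebra (Ideal.span {a})))

instance (a : R) : Algebra R (ReesQ a) :=
  inferInstanceAs (Algebra R (reesAlgebra (Ideal.span {a})))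

/-- The inclusion `𝒯 ⊆ R[t]`. -/
def ReesQ.val (a : R) : ReesQ a →ₐ[R] R[X] := (reesAlgebra (Ideal.span {a})).val

/-- `R[t]` is an algebra over its subring `𝒯`. -/
instance (a : R) : Algebra (ReesQ a) R[X] := (ReesQ.val a).toRingHom.toAlgebra

/-- `Iℛ`, where `ℛ = R[It]`, as a `𝒯`-submodule of `R[t]`. -/
def mulRees (I : Ideal R) (a : I) : Submodule (ReesQ (a : R)) R[X] :=
  Submodule.span _ {f | ∃ x ∈ I, ∃ g ∈ reesAlgebra I, f = C x * g}

/-- `I𝒯`, where `𝒯 = R[Qt]`, as a `𝒯`-submodule of `R[t]`. -/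
def mulReesQ (I : Ideal R) (a : I) : Submodule (ReesQ (a : R)) R[X] :=
  Submodule.span _ {f | ∃ x ∈ I, ∃ g ∈ reesAlgebra (Ideal.span {(a : R)}), f = C x * g}

/-- The Sally module `𝒮_Q(I) = Iℛ/I𝒯` of `I` with respect to `Q = (a)`. -/
abbrev SallyModule (I : Ideal R) (a : I) : Type u :=
  mulRees I a ⧸ (mulReesQ I a).submoduleOf (mulRees I a)

variable [IsLocalRing R]

/-- The ideal `𝔭 = 𝔪𝒯` of `𝒯 = R[Qt]`. -/
def maxRees (a : R) : Ideal (ReesQ a) :=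
  (maximalIdeal R).map (algebraMap R (ReesQ a))

open Classical in
/-- The rank `ℓ_{𝒯_𝔭}(𝒮_Q(I)_𝔭)`, `𝔭 = 𝔪𝒯`, of the Sally module of `I` with respect to `Q = (a)`.
The ideal `𝔭` is prime as soon as `a` is not nilpotent (see `maxRees_isPrime` below); the value
is set to be `0` otherwise. -/
def sallyRank (I : Ideal R) (a : I) : ℕ∞ :=
  if _h : (maxRees (a : R)).IsPrime then
    Module.length (Localization.AtPrime (maxRees (a : R)))
      (LocalizedModule (maxRees (a : R)).primeCompl (SallyModule I a))
  else 0

/-- The ideal `𝔪𝒯` is prime, so that the rank of the Sally module is always the length of an honest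
localization. -/
theorem maxRees_isPrime (a : R) (ha : ¬ IsNilpotent a) : (maxRees a).IsPrime := by
  have hmem : (C a * X : R[X]) ∈ reesAlgebra (Ideal.span {a}) := by
    rw [C_mul_X_eq_monomial]
    exact reesAlgebra.monomial_mem.mpr (by simp)
  let ψ : R[X] →ₐ[R] ReesQ a := aeval ⟨C a * X, hmem⟩
  have hψ (g : R[X]) : ReesQ.val a (ψ g) = g.comp (C a * X) := by
    have h := aeval_algHom_apply (ReesQ.val a) ⟨C a * X, hmem⟩ g
    exact h.symm
  have hcoeff (g : R[X]) (n : ℕ) : (ReesQ.val a (ψ g)).coeff n = g.coeff n * a ^ n := by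
    rw [hψ, comp_C_mul_X_coeff]
  have hsurj : Function.Surjective ψ := by
    rintro ⟨f, hf⟩
    have hf' (i : ℕ) : ∃ u, f.coeff i = u * a ^ i := by
      have := (mem_reesAlgebra_iff _ f).mp hf i
      rw [Ideal.span_singleton_pow] at this
      obtain ⟨u, hu⟩ := Ideal.mem_span_singleton'.mp this
      exact ⟨u, hu.symm⟩
    choose u hu using hf'
    refine ⟨∑ i ∈ f.support, monomial i (u i), Subtype.ext (Polynomial.ext fun n => ?_)⟩
    change (ReesQ.val a (ψ (∑ i ∈ f.support, monomial i (u i)))).coeff n = f.coeff n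
    rw [hcoeff, finsetSum_coeff]
    by_cases hn : n ∈ f.support
    · simp only [coeff_monomial, Finset.sum_ite_eq', hn, if_true, hu n]
    · simp only [coeff_monomial, Finset.sum_ite_eq', hn, if_false, zero_mul]
      exact (notMem_support_iff.mp hn).symm
  have hmap : maxRees a = ((maximalIdeal R).map (C : R →+* R[X])).map (ψ : R[X] →+* ReesQ a) := by
    rw [Ideal.map_map, maxRees]
    congr 1
    ext r : 1
    exact (aeval_C (⟨C a * X, hmem⟩ : ReesQ a) r).symm
  rw [hmap]
  refine Ideal.map_isPrime_of_surjective (f := (ψ : R[X] →+* ReesQ a)) hsurj ?_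
  intro g hg
  refine Ideal.mem_map_C_iff.mpr fun n => ?_
  by_contra hu
  have hz : g.coeff n * a ^ n = 0 := by
    have h0 : ψ g = 0 := hg
    rw [← hcoeff, h0]; simp
  have hunit : IsUnit (g.coeff n) := by
    by_contra h
    exact hu ((mem_maximalIdeal _).mpr h)
  exact ha ⟨n, (hunit.mul_right_eq_zero).mp hz⟩

/-- With respect to the canonical ideal `I` and its parameter reduction `Q = (a)`, the ring `R` is
a 2-almost Gorenstein local ring: the Sally module `𝒮_Q(I)` has rank two. -/
def Is2AGL (I : Ideal R) (a : I) : Prop := sallyRank I a = 2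

end Sally

/-! ### The fractional ideal `K`, the ring `S`, the conductor `𝔠` -/

section Fractional

variable {R : Type u} [CommRing R] (F : Type v) [CommRing F] [Algebra R F]

/-- `K = I/a = {x/a | x ∈ I}` in the total ring of fractions `F` of `R`, i.e. the set of `y ∈ F`
such that `a y` is (the image of) an element of `I`. -/
def fracK (I : Ideal R) (a : I) : Submodule R F :=
  (IsLocalization.coeSubmodule F I).comap (LinearMap.mulLeft R (algebraMap R F a))

/-- `S = R[K]`. -/
def ringS (I : Ideal R) (a : I) : Subalgebra R F := Algebra.adjoin R (fracK F I a : Set F)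

/-- The conductor `𝔠 = R : S` as an `R`-submodule of `F`. The submodule `1` of `F` is `R`, and
`/` is the colon operation inside `F`. -/
def conductorSub (I : Ideal R) (a : I) : Submodule R F :=
  1 / Subalgebra.toSubmodule (ringS F I a)

/-- The conductor `𝔠 = R : S` (which is contained in `R`) as an ideal of `R`. -/
def conductorIdeal (I : Ideal R) (a : I) : Ideal R :=
  (conductorSub F I a).comap (Algebra.linearMap R F)

/-- `K/R` -/
abbrev KModR (I : Ideal R) (a : I) : Type v :=
  fracK F I a ⧸ (1 : Submodule R F).submoduleOf (fracK F I a)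

/-- `S/R` -/
abbrev SModR (I : Ideal R) (a : I) : Type v :=
  Subalgebra.toSubmodule (ringS F I a) ⧸
    (1 : Submodule R F).submoduleOf (Subalgebra.toSubmodule (ringS F I a))

/-- `S/K` -/
abbrev SModK (I : Ideal R) (a : I) : Type v :=
  Subalgebra.toSubmodule (ringS F I a) ⧸
    (fracK F I a).submoduleOf (Subalgebra.toSubmodule (ringS F I a))

variable {F}

theorem one_le_fracK (I : Ideal R) (a : I) : (1 : Submodule R F) ≤ fracK F I a := by
  intro y hy
  obtain ⟨r, rfl⟩ := Submodule.mem_one.mp hy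
  exact ⟨a * r, I.mul_mem_right r a.2, by simp⟩

theorem fracK_le_ringS (I : Ideal R) (a : I) :
    fracK F I a ≤ Subalgebra.toSubmodule (ringS F I a) :=
  fun _ hy => Algebra.subset_adjoin hy

theorem smul_mem_of_mem_conductorIdeal {I : Ideal R} {a : I} {r : R}
    (hr : r ∈ conductorIdeal F I a) {y : F} (hy : y ∈ Subalgebra.toSubmodule (ringS F I a)) :
    r • y ∈ (1 : Submodule R F) := by
  rw [Algebra.smul_def]
  exact Submodule.mem_div_iff_forall_mul_mem.mp hr y hy

theorem isTorsionBySet_quotient {I : Ideal R} {a : I} {M N : Submodule R F}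
    (hM : M ≤ Subalgebra.toSubmodule (ringS F I a)) (hN : 1 ≤ N) :
    Module.IsTorsionBySet R (M ⧸ N.submoduleOf M) (conductorIdeal F I a) := by
  rintro x ⟨r, hr⟩
  obtain ⟨y, rfl⟩ := Submodule.Quotient.mk_surjective _ x
  refine (Submodule.Quotient.mk_eq_zero _).mpr ?_
  exact hN (smul_mem_of_mem_conductorIdeal hr (hM y.2))

variable (F)

/-! The modules `K/R`, `S/R`, `S/K` are killed by `𝔠`; they are `R/𝔠`-modules. -/

instance (I : Ideal R) (a : I) : Module (R ⧸ conductorIdeal F I a) (KModR F I a) :=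
  (isTorsionBySet_quotient (fracK_le_ringS I a) le_rfl).module

instance (I : Ideal R) (a : I) : Module (R ⧸ conductorIdeal F I a) (SModR F I a) :=
  (isTorsionBySet_quotient le_rfl le_rfl).module

instance (I : Ideal R) (a : I) : Module (R ⧸ conductorIdeal F I a) (SModK F I a) :=
  (isTorsionBySet_quotient le_rfl (one_le_fracK I a)).module

/-- The residue field `R/𝔪 = (R/𝔠)/(𝔪/𝔠)` as an `R/𝔠`-module. -/
abbrev ResidueModule [IsLocalRing R] (c : Ideal R) : Type u :=
  (R ⧸ c) ⧸ (maximalIdeal R).map (Ideal.Quotient.mk c)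

end Fractional

/-- `μ_R(M)`, the number of elements in a minimal system of generators of a finitely generated
`R`-module `M`. -/
def mu (R : Type*) [CommRing R] (M : Type*) [AddCommGroup M] [Module R M] : ℕ :=
  (⊤ : Submodule R M).spanFinrank

/-- `x₀, …, xₙ` is a minimal system of generators of the ideal `J`: it generates `J`, and none of
its members can be omitted. -/
def IsMinimalGenerators {R : Type*} [CommRing R] (J : Ideal R) {ι : Type*} (x : ι → R) : Prop :=
  Ideal.span (Set.range x) = J ∧ ∀ i, Ideal.span (x '' {i}ᶜ) ≠ J

end

end TwoAGL

/-! Everything follows from `ℓ(S/K) = 2` together with duality into the canonical module. Write `k =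
R/𝔪`.

Rank and `S/K`. If `I^{n+1} = aI^n`, then `S = K^n = K^{n+1}`, and division by `a^{n+1}` carries the
degree `n` piece `I^{n+1}/aⁿI` of the Sally module to `S/K`. As `a` is a non-zero-divisor, `𝒯` is
the polynomial ring `R[at]`. After localization at `𝔪𝒯`, where `at` becomes a unit, the Sally module
is the base change of this piece along a flat local map with `𝔪` generating the maximal ideal. Such
a base change preserves length, so the rank is `ℓ(S/K)` (`sallyRank_eq_length_component`,
`length_sallyComponent`).

Duality. `Extⁱ(k, K)` is zero for `i = 0, 2` and has length one for `i = 1`, so `Ext¹(-, K)`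
preserves finite lengths. Since `Ext¹(R/J, K) = (K:J)/K`, this gives `ℓ((K:J)/K) = ℓ(R/J)`
(`length_fracK_colon`), hence `K:K = R`, `r = μ(K)` and `ℓ((K:𝔪)/K) = 1`.

Consequences. From `K:K = R` one gets `𝔠 = K:S`, the annihilator of `S/K`. If `𝔪 ⊆ 𝔠`, then `S ⊆
K:𝔪` and `ℓ(S/K) ≤ 1`, which is absurd. So `𝔪(S/K) ≠ 0`, whence `S/K` is cyclic, isomorphic to
`R/𝔠`, and `ℓ(R/𝔠) = 2`. The extension of `S/K` by `K/R` then splits over `R/𝔠`. If `K² ≠ S`, then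
`ℓ(K²/K) ≤ 1` gives `𝔪K ⊆ K:K = R`, even `𝔪K ⊆ 𝔪`, so `𝔪S ⊆ R`, again absurd. Hence `K² = S` and
`R:K = 𝔠`.

Finally `R/𝔠` is local with principal maximal ideal of square zero, so a finite module over it is a
free module plus a `k`-vector space. The numerical claims follow by counting lengths and generators,
using that `1` is a minimal generator of `K` and of `S`. -/

/-! ### Ext and modules of finite length -/

section ExtLength

open CategoryTheory Abelian IsLocalRing

variable {R : Type u} [CommRing R] {M N : Type u} [AddCommGroup M] [Module R M]
  [AddCommGroup N] [Module R N] (Y : ModuleCat.{u} R)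

/-- The contravariant functoriality of `Ext` with respect to linear equivalences. -/
noncomputable def extCongrLeft (e : M ≃ₗ[R] N) (n : ℕ) :
    Ext.{u} (ModuleCat.of R N) Y n ≃ₗ[R] Ext.{u} (ModuleCat.of R M) Y n :=
  LinearEquiv.ofLinearMap
    ((Ext.mk₀ e.toModuleIso.hom).precompOfLinear R Y (zero_add n))
    ((Ext.mk₀ e.toModuleIso.inv).precompOfLinear R Y (zero_add n))
    (by
      ext x
      change (Ext.mk₀ _).comp ((Ext.mk₀ _).comp x (zero_add n)) (zero_add n) = x
      rw [Ext.mk₀_comp_mk₀_assoc, Iso.hom_inv_id, Ext.mk₀_id_comp])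
    (by
      ext x
      change (Ext.mk₀ _).comp ((Ext.mk₀ _).comp x (zero_add n)) (zero_add n) = x
      rw [Ext.mk₀_comp_mk₀_assoc, Iso.inv_hom_id, Ext.mk₀_id_comp])

theorem subsingleton_ext_of_shortExact_middle {S : ShortComplex (ModuleCat.{u} R)}
    (hS : S.ShortExact) (n : ℕ) (h₁ : Subsingleton (Ext.{u} S.X₁ Y n))
    (h₃ : Subsingleton (Ext.{u} S.X₃ Y n)) : Subsingleton (Ext.{u} S.X₂ Y n) := by
  refine subsingleton_of_forall_eq 0 fun x => ?_
  obtain ⟨z, rfl⟩ := Ext.contravariant_sequence_exact₂ hS Y x (Subsingleton.elim _ _)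
  rw [Subsingleton.elim z 0, Ext.comp_zero]

theorem subsingleton_ext_of_shortExact_left {S : ShortComplex (ModuleCat.{u} R)}
    (hS : S.ShortExact) (n : ℕ) (h₂ : Subsingleton (Ext.{u} S.X₂ Y n))
    (h₃ : Subsingleton (Ext.{u} S.X₃ Y (n + 1))) : Subsingleton (Ext.{u} S.X₁ Y n) := by
  refine subsingleton_of_forall_eq 0 fun x => ?_
  obtain ⟨z, rfl⟩ := Ext.contravariant_sequence_exact₁ hS Y x (add_comm 1 n)
    (Subsingleton.elim _ _)
  rw [Subsingleton.elim z 0, Ext.comp_zero]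

theorem subsingleton_ext_of_shortExact_right {S : ShortComplex (ModuleCat.{u} R)}
    (hS : S.ShortExact) (n : ℕ) (h₁ : Subsingleton (Ext.{u} S.X₁ Y n))
    (h₂ : Subsingleton (Ext.{u} S.X₂ Y (n + 1))) : Subsingleton (Ext.{u} S.X₃ Y (n + 1)) := by
  refine subsingleton_of_forall_eq 0 fun x => ?_
  obtain ⟨z, rfl⟩ := Ext.contravariant_sequence_exact₃ hS Y x (Subsingleton.elim _ _)
    (add_comm 1 n)
  rw [Subsingleton.elim z 0, Ext.comp_zero]

/-- The two vanishing hypotheses sit at either end of the degree `n + 1` stretch of the long exact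
sequence and cut it down to a short exact one. -/
theorem length_ext_of_shortExact {S : ShortComplex (ModuleCat.{u} R)}
    (hS : S.ShortExact) (n : ℕ) (h₁ : Subsingleton (Ext.{u} S.X₁ Y n))
    (h₃ : Subsingleton (Ext.{u} S.X₃ Y (n + 2))) :
    Module.length R (Ext.{u} S.X₂ Y (n + 1)) =
      Module.length R (Ext.{u} S.X₃ Y (n + 1)) + Module.length R (Ext.{u} S.X₁ Y (n + 1)) := by
  refine Module.length_eq_add_of_exact
    ((Ext.mk₀ S.g).precompOfLinear R Y (zero_add (n + 1)))
    ((Ext.mk₀ S.f).precompOfLinear R Y (zero_add (n + 1))) ?_ ?_ ?_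
  · rw [injective_iff_map_eq_zero]
    intro x hx
    obtain ⟨z, rfl⟩ := Ext.contravariant_sequence_exact₃ hS Y x hx (add_comm 1 n)
    rw [Subsingleton.elim z 0, Ext.comp_zero]
  · intro x
    obtain ⟨z, hz⟩ := Ext.contravariant_sequence_exact₁ hS Y x (add_comm 1 (n + 1))
      (Subsingleton.elim _ _)
    exact ⟨z, hz⟩
  · intro x
    refine ⟨fun hx => ?_, ?_⟩
    · obtain ⟨z, hz⟩ := Ext.contravariant_sequence_exact₂ hS Y x hx
      exact ⟨z, hz⟩
    · rintro ⟨z, rfl⟩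
      simp

/-- The short exact sequence `0 → N → M → M/N → 0`. -/
abbrev Submodule.shortComplex (N : Submodule R M) : ShortComplex (ModuleCat.{u} R) :=
  ModuleCat.shortComplexOfCompEqZero N.subtype N.mkQ (by ext; simp)

theorem Submodule.shortExact_shortComplex (N : Submodule R M) : N.shortComplex.ShortExact where
  exact := (ShortComplex.ShortExact.moduleCat_exact_iff_function_exact _).mpr
    (LinearMap.exact_subtype_mkQ N)
  mono_f := (ModuleCat.mono_iff_injective _).mpr N.injective_subtype
  epi_g := (ModuleCat.epi_iff_surjective _).mpr N.mkQ_surjective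

variable [IsLocalRing R]

theorem IsSimpleModule.nonempty_equiv_residue [IsSimpleModule R M] :
    Nonempty (M ≃ₗ[R] (R ⧸ maximalIdeal R)) := by
  obtain ⟨m, hm, ⟨e⟩⟩ := isSimpleModule_iff_quot_maximal.mp ‹IsSimpleModule R M›
  obtain rfl := eq_maximalIdeal hm
  exact ⟨e⟩

/-- If `Extⁿ(k, Y) = 0` then `Extⁿ(M, Y) = 0` for all modules `M` of finite length. -/
theorem subsingleton_ext_of_isFiniteLength (n : ℕ)
    (hk : Subsingleton (Ext.{u} (ModuleCat.of R (R ⧸ maximalIdeal R)) Y n))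
    (hM : IsFiniteLength R M) : Subsingleton (Ext.{u} (ModuleCat.of R M) Y n) := by
  induction hM with
  | @of_subsingleton M _ _ _ =>
    refine subsingleton_of_forall_eq 0 fun x => ?_
    rw [← Ext.mk₀_id_comp x, (ModuleCat.isZero_of_subsingleton (ModuleCat.of R M)).eq_of_src
      (𝟙 _) 0, Ext.mk₀_zero, Ext.zero_comp]
  | @of_simple_quotient M _ _ N _ _ ih =>
    obtain ⟨e⟩ := IsSimpleModule.nonempty_equiv_residue (R := R) (M := M ⧸ N)
    exact subsingleton_ext_of_shortExact_middle Y N.shortExact_shortComplex n ih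
      (extCongrLeft Y e n).symm.toEquiv.subsingleton

/-- If `Ext⁰(k, Y) = Ext²(k, Y) = 0` and `Ext¹(k, Y)` has length one, then `Ext¹(-, Y)` preserves
the length of modules of finite length. -/
theorem length_ext_one_of_isFiniteLength
    (h0 : Subsingleton (Ext.{u} (ModuleCat.of R (R ⧸ maximalIdeal R)) Y 0))
    (h1 : Module.length R (Ext.{u} (ModuleCat.of R (R ⧸ maximalIdeal R)) Y 1) = 1)
    (h2 : Subsingleton (Ext.{u} (ModuleCat.of R (R ⧸ maximalIdeal R)) Y 2))
    (hM : IsFiniteLength R M) :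
    Module.length R (Ext.{u} (ModuleCat.of R M) Y 1) = Module.length R M := by
  induction hM with
  | @of_subsingleton M _ _ _ =>
    have : Subsingleton (Ext.{u} (ModuleCat.of R M) Y 1) := by
      refine subsingleton_of_forall_eq 0 fun x => ?_
      rw [← Ext.mk₀_id_comp x, (ModuleCat.isZero_of_subsingleton (ModuleCat.of R M)).eq_of_src
        (𝟙 _) 0, Ext.mk₀_zero, Ext.zero_comp]
    simp
  | @of_simple_quotient M _ _ N _ hN ih =>
    obtain ⟨e⟩ := IsSimpleModule.nonempty_equiv_residue (R := R) (M := M ⧸ N)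
    -- `Ext⁰(N, Y) = 0` and `Ext²(M/N, Y) = 0` make `Ext¹(-, Y)` exact on `0 → N → M → M/N → 0`.
    have h := length_ext_of_shortExact Y N.shortExact_shortComplex 0
      (subsingleton_ext_of_isFiniteLength Y 0 h0 hN)
      (extCongrLeft Y e 2).symm.toEquiv.subsingleton
    have h' := Module.length_eq_add_of_exact N.subtype N.mkQ N.injective_subtype N.mkQ_surjective
      (LinearMap.exact_subtype_mkQ N)
    have h3 : Module.length R (Ext.{u} (ModuleCat.of R (M ⧸ N)) Y 1) = 1 :=
      (extCongrLeft Y e 1).symm.length_eq.trans h1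
    rw [h', Module.length_eq_one R (M ⧸ N), ← ih, add_comm, ← h3]
    exact h

omit [IsLocalRing R] in
/-- The modules `Extⁿ(R/xR, Y)`, `n ≥ 2`, vanish when `x` is a non-zero-divisor. -/
theorem subsingleton_ext_quotient_span_singleton {x : R} (hx : x ∈ nonZeroDivisors R) (n : ℕ) :
    Subsingleton (Ext.{u} (ModuleCat.of R (R ⧸ Ideal.span {x})) Y (n + 2)) := by
  have hx' : IsLeftRegular x := (isRegular_iff_mem_nonZeroDivisors.mpr hx).left
  let e : R ≃ₗ[R] (Ideal.span {x} : Ideal R) := by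
    refine LinearEquiv.ofBijective ((LinearMap.toSpanSingleton R R x).codRestrict _
      fun r => Ideal.mul_mem_left _ r (Ideal.mem_span_singleton_self x)) ⟨?_, ?_⟩
    · intro r s h
      have : r * x = s * x := congrArg Subtype.val h
      exact hx' (by simpa [mul_comm] using this)
    · rintro ⟨y, hy⟩
      obtain ⟨r, rfl⟩ := Ideal.mem_span_singleton'.mp hy
      exact ⟨r, rfl⟩
  have hP : ∀ m : ℕ, Subsingleton (Ext.{u} (ModuleCat.of R R) Y (m + 1)) := fun m =>
    Ext.subsingleton_of_projective _ _ _
  -- `xR` is free, so its Ext vanishes from degree one on; the shift by one gives degree two for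
  -- `R/xR`.
  exact subsingleton_ext_of_shortExact_right Y
    (Submodule.shortExact_shortComplex (Ideal.span {x} : Ideal R)) (n + 1)
    ((extCongrLeft Y e (n + 1)).toEquiv.subsingleton_congr.mpr (hP n)) (hP (n + 1))

/-- Over a local ring with a non-zero-divisor `x` such that `R/xR` has finite length, a module of
finite injective dimension has `Extⁿ(k, Y) = 0` for all `n ≥ 2`. -/
theorem subsingleton_ext_residue {x : R} (hx : x ∈ nonZeroDivisors R) (hxm : x ∈ maximalIdeal R)
    (hfin : IsFiniteLength R (R ⧸ Ideal.span {x})) {d : ℕ}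
    (hY : HasInjectiveDimensionLE Y d) (n : ℕ) :
    Subsingleton (Ext.{u} (ModuleCat.of R (R ⧸ maximalIdeal R)) Y (n + 2)) := by
  obtain ⟨hN, hA⟩ := isFiniteLength_iff_isNoetherian_isArtinian.mp hfin
  have hnt : Nontrivial (R ⧸ Ideal.span {x}) := Ideal.Quotient.nontrivial_iff.mpr fun h =>
    (Ideal.ne_top_iff_one _).mp (maximalIdeal.isMaximal R).ne_top <|
      (Ideal.span_singleton_le_iff_mem (maximalIdeal R)).mpr hxm (h ▸ Submodule.mem_top)
  -- A copy of `k` inside `R/xR`, which exists because `R/xR` is nonzero and Artinian.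
  obtain ⟨N, hN'⟩ := IsAtomic.exists_atom (Submodule R (R ⧸ Ideal.span {x}))
  have hs : IsSimpleModule R N := isSimpleModule_iff_isAtom.mpr hN'
  obtain ⟨e⟩ := IsSimpleModule.nonempty_equiv_residue (R := R) (M := N)
  -- Descending induction on the degree, starting above the injective dimension. `Ext^{n+2}(k, Y)`
  -- lies between `Ext^{n+2}(R/xR, Y) = 0` and `Ext^{n+3}` of the finite length module `(R/xR)/k`,
  -- which vanishes by induction.
  have key : ∀ k n : ℕ, d < n + k + 2 →
      Subsingleton (Ext.{u} (ModuleCat.of R (R ⧸ maximalIdeal R)) Y (n + 2)) := by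
    intro k
    induction k with
    | zero =>
      intro n hn
      exact HasInjectiveDimensionLT.subsingleton Y (d + 1) (n + 2) (by omega) _
    | succ k ih =>
      intro n hn
      have h1 := ih (n + 1) (by omega)
      have hq : IsFiniteLength R ((R ⧸ Ideal.span {x}) ⧸ N) :=
        hfin.of_surjective N.mkQ_surjective
      have h2 := subsingleton_ext_of_isFiniteLength Y (n + 1 + 2) h1 hq
      have h3 := subsingleton_ext_of_shortExact_left Y N.shortExact_shortComplex (n + 2)
        (subsingleton_ext_quotient_span_singleton Y hx n) h2
      exact (extCongrLeft Y e (n + 2)).toEquiv.subsingleton_congr.mpr h3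
  exact key d n (by omega)

end ExtLength

/-! ### Colon modules as Ext modules -/

section ExtColon

open CategoryTheory Abelian IsLocalRing

variable {R : Type u} [CommRing R] {F : Type v} [CommRing F] [Algebra R F]
  {M : Type u} [AddCommGroup M] [Module R M] {N : Submodule R F}

/-- Multiplication by elements of the colon module `N : J` as homomorphisms `J → N`. -/
noncomputable def colonToHom (N : Submodule R F) (J : Ideal R) :
    ↥(N / IsLocalization.coeSubmodule F J) →ₗ[R] (J →ₗ[R] N) :=
  LinearMap.mk₂ R
    (fun y j => ⟨(y : F) * algebraMap R F j, Submodule.mem_div_iff_forall_mul_mem.mp y.2 _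
      ((IsLocalization.mem_coeSubmodule F J).mpr ⟨j, j.2, rfl⟩)⟩)
    (fun y z j => Subtype.ext (by simp [add_mul]))
    (fun r y j => Subtype.ext (by simp))
    (fun y j j' => Subtype.ext (by simp [mul_add]))
    (fun r y j => Subtype.ext (by simp [Algebra.smul_def, mul_left_comm]))

theorem colonToHom_apply_coe (J : Ideal R) (y : ↥(N / IsLocalization.coeSubmodule F J)) (j : J) :
    (colonToHom N J y j : F) = y * algebraMap R F j := rfl

variable [IsFractionRing R F]

theorem colonToHom_surjective {J : Ideal R} {d : R} (hd : d ∈ nonZeroDivisors R) (hdJ : d ∈ J) :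
    Function.Surjective (colonToHom N J) := by
  intro f
  obtain ⟨u, hu⟩ := IsLocalization.map_units F (⟨d, hd⟩ : nonZeroDivisors R)
  have hu : (u : F) = algebraMap R F d := hu
  -- From `j f(d) = d f(j)`, the map `f` is multiplication by `f(d)/d`.
  have key : ∀ j : J, (↑u⁻¹ * (f ⟨d, hdJ⟩ : F)) * algebraMap R F j = f j := by
    intro j
    have h1 : f ((j : R) • (⟨d, hdJ⟩ : J)) = f (d • j) :=
      congrArg f (Subtype.ext (mul_comm _ _))
    rw [map_smul, map_smul] at h1
    have h2 : algebraMap R F j * (f ⟨d, hdJ⟩ : F) = algebraMap R F d * f j := by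
      simpa [Algebra.smul_def] using congrArg Subtype.val h1
    rw [mul_assoc, mul_comm (f ⟨d, hdJ⟩ : F), h2, ← hu, Units.inv_mul_cancel_left]
  refine ⟨⟨↑u⁻¹ * (f ⟨d, hdJ⟩ : F), Submodule.mem_div_iff_forall_mul_mem.mpr ?_⟩, ?_⟩
  · intro z hz
    obtain ⟨j, hj, rfl⟩ := (IsLocalization.mem_coeSubmodule F J).mp hz
    rw [key ⟨j, hj⟩]
    exact (f _).2
  · ext j
    exact key j

/-- If `M` is isomorphic to a submodule `N` of the total ring of fractions, then `Ext¹(R/J, M)`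
is isomorphic to `(N : J)/N`, for every ideal `J` containing a non-zero-divisor. -/
theorem nonempty_ext_one_quotient_equiv (e : M ≃ₗ[R] N) {J : Ideal R} {d : R}
    (hd : d ∈ nonZeroDivisors R) (hdJ : d ∈ J) :
    Nonempty ((↥(N / IsLocalization.coeSubmodule F J) ⧸
        N.submoduleOf (N / IsLocalization.coeSubmodule F J)) ≃ₗ[R]
      Ext.{u} (ModuleCat.of R (R ⧸ J)) (ModuleCat.of R M) 1) := by
  have hS := Submodule.shortExact_shortComplex (J : Submodule R R)
  let α : (J →ₗ[R] N) ≃ₗ[R] Ext.{u} (ModuleCat.of R J) (ModuleCat.of R M) 0 :=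
    ((LinearEquiv.congrRight e.symm).trans (ModuleCat.homLinearEquiv (S := R)
      (M := ModuleCat.of R J) (N := ModuleCat.of R M)).symm).trans (Ext.linearEquiv₀ (R := R)).symm
  have hα : ∀ f : J →ₗ[R] N,
      α f = Ext.mk₀ (ModuleCat.ofHom (e.symm.toLinearMap ∘ₗ f)) := fun _ => rfl
  -- The connecting map `Hom(J, M) → Ext¹(R/J, M)`, read on `N : J`. It is onto because `Ext¹(R, M)
  -- = 0`; its kernel consists of the maps that extend to `R`, that is, multiplications by elements
  -- of `N`.
  let ψ : ↥(N / IsLocalization.coeSubmodule F J) →ₗ[R]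
      Ext.{u} (ModuleCat.of R (R ⧸ J)) (ModuleCat.of R M) 1 :=
    (hS.extClass.precompOfLinear R (ModuleCat.of R M) (add_zero 1)) ∘ₗ α.toLinearMap ∘ₗ
      colonToHom N J
  have hψ : ∀ y, ψ y = hS.extClass.comp (α (colonToHom N J y)) (add_zero 1) := fun _ => rfl
  have hsurj : Function.Surjective ψ := by
    intro x
    have : Subsingleton (Ext.{u} (ModuleCat.of R R) (ModuleCat.of R M) 1) :=
      Ext.subsingleton_of_projective _ _ 0
    obtain ⟨z, hz⟩ := Ext.contravariant_sequence_exact₃ hS (ModuleCat.of R M) x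
      (Subsingleton.elim (α := Ext.{u} (ModuleCat.of R R) (ModuleCat.of R M) 1) _ _) (add_zero 1)
    obtain ⟨f, rfl⟩ := α.surjective z
    obtain ⟨y, rfl⟩ := colonToHom_surjective hd hdJ f
    exact ⟨y, hz⟩
  have hker : LinearMap.ker ψ = N.submoduleOf (N / IsLocalization.coeSubmodule F J) := by
    ext y
    rw [LinearMap.mem_ker, hψ]
    constructor
    · intro h
      obtain ⟨z, hz⟩ := Ext.contravariant_sequence_exact₁ hS (ModuleCat.of R M) _ (add_zero 1) h
      obtain ⟨g, rfl⟩ := (Ext.linearEquiv₀ (R := R)).symm.surjective z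
      have h1 : Ext.mk₀ (ModuleCat.ofHom (e.symm.toLinearMap ∘ₗ colonToHom N J y)) =
          Ext.mk₀ ((Submodule.shortComplex (J : Submodule R R)).f ≫ g) := by
        rw [← hα, ← hz]
        exact Ext.mk₀_comp_mk₀ _ _
      have h2 := (Ext.mk₀_bijective _ _).1 h1
      have h3 : e.symm (colonToHom N J y ⟨d, hdJ⟩) = g.hom d :=
        congrArg (fun f => ModuleCat.Hom.hom f (⟨d, hdJ⟩ : J)) h2
      have h4 : g.hom d = d • g.hom (1 : R) := by
        rw [← map_smul, smul_eq_mul, mul_one]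
      rw [h4, LinearEquiv.symm_apply_eq, map_smul] at h3
      have h5 : (y : F) * algebraMap R F d = algebraMap R F d * (e (g.hom (1 : R)) : F) := by
        simpa [Algebra.smul_def, colonToHom_apply_coe] using congrArg Subtype.val h3
      rw [mul_comm] at h5
      have h6 : (y : F) = e (g.hom (1 : R)) :=
        (IsLocalization.map_units F (⟨d, hd⟩ : nonZeroDivisors R)).mul_left_cancel h5
      change (y : F) ∈ N
      rw [h6]
      exact (e _).2
    · intro h
      have hy : (y : F) ∈ N := h
      let g : R →ₗ[R] M := LinearMap.toSpanSingleton R M (e.symm ⟨y, hy⟩)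
      have h1 : α (colonToHom N J y) =
          (Ext.mk₀ (Submodule.shortComplex (J : Submodule R R)).f).comp
            (Ext.mk₀ (ModuleCat.ofHom g)) (add_zero 0) := by
        rw [hα, Ext.mk₀_comp_mk₀]
        congr 1
        ext j
        change e.symm (colonToHom N J y j) = (j : R) • e.symm ⟨y, hy⟩
        rw [← map_smul]
        congr 1
        refine Subtype.ext ?_
        simp [colonToHom_apply_coe, Algebra.smul_def, mul_comm]
      rw [h1, hS.extClass_comp_assoc]
  exact ⟨(Submodule.quotEquivOfEq _ _ hker.symm).trans (ψ.quotKerEquivOfSurjective hsurj)⟩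

/-- A non-zero-divisor in `J` forces `Hom(R/J, M) = 0` for `M` torsion-free. -/
theorem subsingleton_ext_zero_quotient (e : M ≃ₗ[R] N) {J : Ideal R} {d : R}
    (hd : d ∈ nonZeroDivisors R) (hdJ : d ∈ J) :
    Subsingleton (Ext.{u} (ModuleCat.of R (R ⧸ J)) (ModuleCat.of R M) 0) := by
  refine ((Ext.linearEquiv₀ (R := R)).trans ModuleCat.homLinearEquiv).toEquiv.subsingleton_congr.mpr
    (subsingleton_of_forall_eq 0 fun f => ?_)
  have h0 : ∀ m : M, d • m = 0 → m = 0 := by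
    intro m hm
    have h1 : algebraMap R F d * (e m : F) = 0 := by
      simpa [Algebra.smul_def] using congrArg Subtype.val (congrArg e hm)
    have h2 : (e m : F) = 0 :=
      (IsLocalization.map_units F (⟨d, hd⟩ : nonZeroDivisors R)).mul_right_eq_zero.mp h1
    exact e.map_eq_zero_iff.mp (Subtype.ext h2)
  refine LinearMap.ext fun z => h0 _ ?_
  change d • f z = 0
  rw [← map_smul]
  obtain ⟨r, rfl⟩ := Ideal.Quotient.mk_surjective z
  have : d • (Ideal.Quotient.mk J r) = 0 := by
    change Ideal.Quotient.mk J (d * r) = 0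
    exact Ideal.Quotient.eq_zero_iff_mem.mpr (J.mul_mem_right r hdJ)
  rw [this, map_zero]

/-- Duality into a module `N ⊆ F` of type one and finite injective dimension. -/
theorem length_colon_quotient [IsLocalRing R] (e : M ≃ₗ[R] N) {x : R}
    (hx : x ∈ nonZeroDivisors R) (hxm : x ∈ maximalIdeal R)
    (hfin : IsFiniteLength R (R ⧸ Ideal.span {x})) {n : ℕ}
    (hM : HasInjectiveDimensionLE (ModuleCat.of R M) n)
    (h1 : Module.length R (Ext.{u} (ModuleCat.of R (R ⧸ maximalIdeal R)) (ModuleCat.of R M) 1) = 1)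
    {J : Ideal R} {d : R} (hd : d ∈ nonZeroDivisors R) (hdJ : d ∈ J)
    (hJ : IsFiniteLength R (R ⧸ J)) :
    Module.length R (↥(N / IsLocalization.coeSubmodule F J) ⧸
        N.submoduleOf (N / IsLocalization.coeSubmodule F J)) = Module.length R (R ⧸ J) := by
  obtain ⟨α⟩ := nonempty_ext_one_quotient_equiv e hd hdJ
  rw [α.length_eq]
  exact length_ext_one_of_isFiniteLength _ (subsingleton_ext_zero_quotient e hx hxm) h1
    (subsingleton_ext_residue _ hx hxm hfin hM 0) hJ

end ExtColon

namespace TwoAGL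

/-! ### The Sally module and its rank -/

section SallyRank

open Polynomial IsLocalRing TensorProduct

variable {R : Type u} [CommRing R]

instance (a : R) : IsScalarTower R (ReesQ a) R[X] :=
  IsScalarTower.of_algebraMap_eq fun _ => rfl

theorem ReesQ.smul_def {a : R} (t : ReesQ a) (f : R[X]) : t • f = ReesQ.val a t * f := rfl

theorem ReesQ.val_injective (a : R) : Function.Injective (ReesQ.val a) := Subtype.val_injective

theorem ReesQ.val_mem {a : R} (t : ReesQ a) : ReesQ.val a t ∈ reesAlgebra (Ideal.span {a}) := t.2

theorem C_mul_X_mem_reesAlgebra (a : R) : (C a * X : R[X]) ∈ reesAlgebra (Ideal.span {a}) := by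
  rw [C_mul_X_eq_monomial]
  exact reesAlgebra.monomial_mem.mpr (by simp)

/-- The element `at` of `R[Qt]`, `Q = (a)`. -/
noncomputable def ReesQ.gen (a : R) : ReesQ a :=
  (⟨C a * X, C_mul_X_mem_reesAlgebra a⟩ : reesAlgebra (Ideal.span {a}))

theorem ReesQ.val_aeval_gen (a : R) (g : R[X]) :
    ReesQ.val a (aeval (ReesQ.gen a) g) = g.comp (C a * X) :=
  (aeval_algHom_apply (ReesQ.val a) (ReesQ.gen a) g).symm

/-- The map multiplies the coefficient of degree `n` by `aⁿ`: this is injective for a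
non-zero-divisor, and every coefficient allowed in `R[Qt]` is such a multiple. -/
theorem ReesQ.aeval_gen_bijective {a : R} (ha : a ∈ nonZeroDivisors R) :
    Function.Bijective (aeval (R := R) (ReesQ.gen a)) := by
  have hcoeff (g : R[X]) (n : ℕ) :
      (ReesQ.val a (aeval (ReesQ.gen a) g)).coeff n = g.coeff n * a ^ n := by
    rw [ReesQ.val_aeval_gen, comp_C_mul_X_coeff]
  constructor
  · rw [injective_iff_map_eq_zero]
    intro g hg
    ext n
    have h := hcoeff g n
    rw [hg, map_zero, coeff_zero] at h
    exact (mul_right_mem_nonZeroDivisors_eq_zero_iff (pow_mem ha n)).mp h.symm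
  · intro t
    have hf' (i : ℕ) : ∃ u, (ReesQ.val a t).coeff i = u * a ^ i := by
      have := (mem_reesAlgebra_iff _ _).mp (ReesQ.val_mem t) i
      rw [Ideal.span_singleton_pow] at this
      obtain ⟨u, hu⟩ := Ideal.mem_span_singleton'.mp this
      exact ⟨u, hu.symm⟩
    choose u hu using hf'
    refine ⟨∑ i ∈ (ReesQ.val a t).support, monomial i (u i),
      ReesQ.val_injective a (Polynomial.ext fun n => ?_)⟩
    rw [hcoeff, finsetSum_coeff]
    by_cases hn : n ∈ (ReesQ.val a t).support
    · simp only [coeff_monomial, Finset.sum_ite_eq', hn, if_true, hu n]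
    · simp only [coeff_monomial, Finset.sum_ite_eq', hn, if_false, zero_mul]
      exact (notMem_support_iff.mp hn).symm

/-- For a non-zero-divisor `a`, `R[Qt]` is a polynomial ring in `at`. -/
noncomputable def ReesQ.equiv {a : R} (ha : a ∈ nonZeroDivisors R) : R[X] ≃ₐ[R] ReesQ a :=
  AlgEquiv.ofBijective (aeval (ReesQ.gen a)) (ReesQ.aeval_gen_bijective ha)

/-- The basis of `R[Qt]` given by the powers of `at`. -/
noncomputable def ReesQ.basis {a : R} (ha : a ∈ nonZeroDivisors R) : Module.Basis ℕ R (ReesQ a) :=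
  (Polynomial.basisMonomials R).map (ReesQ.equiv ha).toLinearEquiv

theorem ReesQ.basis_apply {a : R} (ha : a ∈ nonZeroDivisors R) (i : ℕ) :
    ReesQ.basis ha i = ReesQ.gen a ^ i := by
  simp [ReesQ.basis, ReesQ.equiv, AlgEquiv.toLinearEquiv_apply, ← X_pow_eq_monomial]

theorem ReesQ.gen_pow_smul (a : R) (i : ℕ) (f : R[X]) :
    ReesQ.gen a ^ i • f = C (a ^ i) * X ^ i * f := by
  rw [ReesQ.smul_def, map_pow]
  change (C a * X) ^ i * f = _
  rw [mul_pow, C_pow]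

theorem ReesQ.gen_pow_smul_monomial (a : R) (i n : ℕ) (r : R) :
    ReesQ.gen a ^ i • (monomial n r : R[X]) = monomial (n + i) (a ^ i * r) := by
  rw [ReesQ.gen_pow_smul, C_mul_X_pow_eq_monomial, monomial_mul_monomial, add_comm]

/-- `J = I` gives `Iℛ` and `J = (a)` gives `I𝒯`. Since `a ∈ J`, multiplication by `𝒯` respects the
grading by the ideals `IJⁿ`. -/
theorem mem_span_C_mul_reesAlgebra_iff {I J : Ideal R} {a : R} (ha : a ∈ J) (f : R[X]) :
    f ∈ Submodule.span (ReesQ a) {f : R[X] | ∃ x ∈ I, ∃ g ∈ reesAlgebra J, f = C x * g} ↔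
      ∀ n, f.coeff n ∈ I * J ^ n := by
  constructor
  · intro hf
    induction hf using Submodule.span_induction with
    | mem f hf =>
      obtain ⟨x, hx, g, hg, rfl⟩ := hf
      intro n
      rw [coeff_C_mul]
      exact Ideal.mul_mem_mul hx ((mem_reesAlgebra_iff _ _).mp hg n)
    | zero => simp
    | add f g _ _ hf hg => intro n; rw [coeff_add]; exact add_mem (hf n) (hg n)
    | smul t f _ hf =>
      intro n
      rw [ReesQ.smul_def, coeff_mul]
      refine sum_mem fun p hp => ?_
      have h1 := (mem_reesAlgebra_iff _ _).mp (ReesQ.val_mem t) p.1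
      have h2 : (ReesQ.val a t).coeff p.1 ∈ J ^ p.1 :=
        Ideal.pow_right_mono ((Ideal.span_singleton_le_iff_mem J).mpr ha) _ h1
      have h3 := Ideal.mul_mem_mul h2 (hf p.2)
      rwa [mul_left_comm, ← pow_add, Finset.HasAntidiagonal.mem_antidiagonal.mp hp] at h3
  · intro hf
    rw [← sum_monomial_eq f, Polynomial.sum]
    refine sum_mem fun n _ => ?_
    have h := hf n
    generalize f.coeff n = r at h
    induction h using Submodule.mul_induction_on' with
    | mem_mul_mem x hx y hy =>
      exact Submodule.subset_span ⟨x, hx, monomial n y, reesAlgebra.monomial_mem.mpr hy,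
        (C_mul_monomial).symm⟩
    | add x _ y _ hx hy => rw [map_add]; exact add_mem hx hy

theorem mem_mulRees_iff {I : Ideal R} {a : I} {f : R[X]} :
    f ∈ mulRees I a ↔ ∀ n, f.coeff n ∈ I ^ (n + 1) := by
  simp only [pow_succ']
  exact mem_span_C_mul_reesAlgebra_iff a.2 f

theorem mem_mulReesQ_iff {I : Ideal R} {a : I} {f : R[X]} :
    f ∈ mulReesQ I a ↔ ∀ n, f.coeff n ∈ I * Ideal.span {(a : R)} ^ n :=
  mem_span_C_mul_reesAlgebra_iff (Ideal.mem_span_singleton_self _) f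

theorem monomial_mem_mulRees {I : Ideal R} {a : I} {n : ℕ} {r : R} (hr : r ∈ I ^ (n + 1)) :
    monomial n r ∈ mulRees I a := by
  rw [mem_mulRees_iff]
  intro m
  rw [coeff_monomial]
  split_ifs with h
  · exact h ▸ hr
  · exact zero_mem _

/-- The homogeneous component `I^{n+1}/Qⁿ I` of degree `n` of the Sally module. -/
abbrev SallyComponent (I : Ideal R) (a : I) (n : ℕ) : Type u :=
  ↥(I ^ (n + 1)) ⧸ (I * Ideal.span {(a : R)} ^ n).submoduleOf (I ^ (n + 1))

/-- The inclusion of the component of degree `n` into the Sally module. -/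
noncomputable def sallyComponentIncl (I : Ideal R) (a : I) (n : ℕ) :
    SallyComponent I a n →ₗ[R] SallyModule I a :=
  Submodule.liftQ _
    (((mulReesQ I a).submoduleOf (mulRees I a)).mkQ.restrictScalars R ∘ₗ
      ((monomial n : R →ₗ[R] R[X]) ∘ₗ (I ^ (n + 1)).subtype).codRestrict
        ((mulRees I a).restrictScalars R) fun r => monomial_mem_mulRees r.2) (by
    intro r hr
    have hr' : (r : R) ∈ I * Ideal.span {(a : R)} ^ n := hr
    refine (Submodule.Quotient.mk_eq_zero _).mpr ?_
    change monomial n (r : R) ∈ mulReesQ I a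
    rw [mem_mulReesQ_iff]
    intro m
    rw [coeff_monomial]
    split_ifs with h
    · exact h ▸ hr'
    · exact zero_mem _)

theorem sallyComponentIncl_mk (I : Ideal R) (a : I) (n : ℕ) (r : ↥(I ^ (n + 1))) :
    sallyComponentIncl I a n (Submodule.Quotient.mk r) =
      Submodule.Quotient.mk ⟨monomial n (r : R), monomial_mem_mulRees r.2⟩ := rfl

/-- The map from `𝒯 ⊗ I^{n+1}/QⁿI` to the Sally module. -/
noncomputable def sallyMap (I : Ideal R) (a : I) (n : ℕ) :
    ReesQ (a : R) ⊗[R] SallyComponent I a n →ₗ[ReesQ (a : R)] SallyModule I a :=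
  (sallyComponentIncl I a n).liftBaseChange _

theorem sallyMap_gen_pow_tmul (I : Ideal R) (a : I) (n i : ℕ) (r : ↥(I ^ (n + 1))) :
    sallyMap I a n ((ReesQ.gen (a : R) ^ i) ⊗ₜ Submodule.Quotient.mk r) =
      Submodule.Quotient.mk ⟨ReesQ.gen (a : R) ^ i • monomial n (r : R),
        Submodule.smul_mem _ _ (monomial_mem_mulRees r.2)⟩ := by
  rw [sallyMap, LinearMap.liftBaseChange_tmul, sallyComponentIncl_mk, ← Submodule.Quotient.mk_smul]
  rfl

theorem pow_eq_span_pow_mul {I J : Ideal R} {n : ℕ} (h : I ^ (n + 1) = J * I ^ n) (k : ℕ) :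
    I ^ (n + k) = J ^ k * I ^ n := by
  induction k with
  | zero => simp
  | succ k ih =>
    rw [← add_assoc, pow_succ, ih, mul_assoc, ← pow_succ, h, ← mul_assoc, ← pow_succ]

/-- The source is the direct sum of copies of `I^{n+1}/QⁿI` indexed by the powers of `at`, and
distinct powers land in distinct degrees, so each summand can be tested separately. -/
theorem sallyMap_injective (I : Ideal R) (a : I) (ha : (a : R) ∈ nonZeroDivisors R) (n : ℕ) :
    Function.Injective (sallyMap I a n) := by
  rw [injective_iff_map_eq_zero]
  intro z hz
  let β := TensorProduct.equivFinsuppOfBasisLeft (N := SallyComponent I a n) (ReesQ.basis ha)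
  obtain ⟨v, rfl⟩ := β.symm.surjective z
  suffices hv : v = 0 by rw [hv, map_zero]
  choose r hr using fun i => Submodule.Quotient.mk_surjective _ (v i)
  have h1 : sallyMap I a n (β.symm v) = ∑ i ∈ v.support, Submodule.Quotient.mk
      ⟨ReesQ.gen (a : R) ^ i • monomial n (r i : R),
        Submodule.smul_mem _ _ (monomial_mem_mulRees (r i).2)⟩ := by
    rw [TensorProduct.equivFinsuppOfBasisLeft_symm_apply, Finsupp.sum, map_sum]
    refine Finset.sum_congr rfl fun i _ => ?_
    rw [ReesQ.basis_apply, ← hr i, sallyMap_gen_pow_tmul]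
  have h2 : (∑ i ∈ v.support, ReesQ.gen (a : R) ^ i • monomial n (r i : R)) ∈ mulReesQ I a := by
    rw [h1] at hz
    have h3 := (Submodule.Quotient.mk_eq_zero
      ((mulReesQ I a).submoduleOf (mulRees I a)) (x := ∑ i ∈ v.support,
      ⟨ReesQ.gen (a : R) ^ i • monomial n (r i : R),
        Submodule.smul_mem _ _ (monomial_mem_mulRees (r i).2)⟩)).mp
        (by rw [← hz]; exact map_sum (Submodule.mkQ _) _ _)
    have h4 := Submodule.mem_comap.mp h3
    rw [map_sum] at h4
    exact h4
  rw [mem_mulReesQ_iff] at h2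
  ext i
  by_cases hi : i ∈ v.support
  swap
  · exact Finsupp.notMem_support_iff.mp hi
  -- In degree `n + i` only the `i`-th summand `aⁱ rᵢ` survives; cancelling `aⁱ` from `aⁱ rᵢ ∈ I
  -- Q^{n+i}` leaves `rᵢ ∈ I Qⁿ`.
  have h3 := h2 (n + i)
  rw [finsetSum_coeff, Finset.sum_eq_single i] at h3
  · rw [ReesQ.gen_pow_smul_monomial, coeff_monomial, if_pos rfl, add_comm n i, pow_add,
      mul_left_comm, Ideal.span_singleton_pow (a : R) i] at h3
    obtain ⟨s, hs, hs'⟩ := Ideal.mem_span_singleton_mul.mp h3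
    have h4 : s = r i :=
      (isRegular_iff_mem_nonZeroDivisors.mpr (pow_mem ha i)).left hs'
    rw [← hr i]
    refine (Submodule.Quotient.mk_eq_zero _).mpr ?_
    change (r i : R) ∈ I * Ideal.span {(a : R)} ^ n
    exact h4 ▸ hs
  · intro j _ hj
    rw [ReesQ.gen_pow_smul_monomial, coeff_monomial, if_neg (by omega)]
  · exact fun h => absurd hi h

/-- The cokernel of `sallyMap` is killed by `(at)ⁿ`, hence disappears in the localization at `𝔪𝒯`.
-/
theorem exists_sallyMap_eq_gen_pow_smul (I : Ideal R) (a : I) {n : ℕ}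
    (h : I ^ (n + 1) = Ideal.span {(a : R)} * I ^ n) (s : SallyModule I a) :
    ∃ z, sallyMap I a n z = ReesQ.gen (a : R) ^ n • s := by
  obtain ⟨⟨g, hg⟩, rfl⟩ := Submodule.Quotient.mk_surjective _ s
  rw [mem_mulRees_iff] at hg
  -- `aⁿ gᵢ ∈ I^{n+1+i} = aⁱ I^{n+1}`, so `(at)ⁿ gᵢ tⁱ` can be rewritten as `(at)ⁱ rᵢ tⁿ`.
  have hr : ∀ i, ∃ r : ↥(I ^ (n + 1)), (a : R) ^ i * r = a ^ n * g.coeff i := by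
    intro i
    have h1 : (a : R) ^ n * g.coeff i ∈ I ^ (n + 1 + i) := by
      rw [show n + 1 + i = n + (i + 1) by ring, pow_add]
      exact Ideal.mul_mem_mul (Ideal.pow_mem_pow a.2 n) (hg i)
    have h2 : I ^ (n + 1 + 1) = Ideal.span {(a : R)} * I ^ (n + 1) := by
      rw [pow_succ, h, mul_assoc, ← pow_succ, ← h]
    rw [pow_eq_span_pow_mul h2, Ideal.span_singleton_pow] at h1
    obtain ⟨s, hs, hs'⟩ := Ideal.mem_span_singleton_mul.mp h1
    exact ⟨⟨s, hs⟩, hs'⟩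
  choose r hr using hr
  refine ⟨∑ i ∈ g.support, (ReesQ.gen (a : R) ^ i) ⊗ₜ Submodule.Quotient.mk (r i), ?_⟩
  rw [map_sum]
  simp only [sallyMap_gen_pow_tmul]
  rw [← Submodule.Quotient.mk_smul]
  refine (map_sum (Submodule.mkQ _) _ _).symm.trans (congrArg _ (Subtype.ext ?_))
  rw [AddSubmonoidClass.coe_finsetSum]
  change _ = ReesQ.gen (a : R) ^ n • g
  conv_rhs => rw [← sum_monomial_eq g, Polynomial.sum, Finset.smul_sum]
  refine Finset.sum_congr rfl fun i _ => ?_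
  change ReesQ.gen (a : R) ^ i • monomial n (r i : R) = _
  rw [ReesQ.gen_pow_smul_monomial, ReesQ.gen_pow_smul_monomial, hr, add_comm]

variable [IsLocalRing R]

/-- Under `R[X] ≅ 𝒯`, the ideal `𝔪𝒯` is the set of polynomials with all coefficients in `𝔪`, and
`Xⁿ` has coefficient `1`. -/
theorem ReesQ.gen_pow_notMem_maxRees {a : R} (ha : a ∈ nonZeroDivisors R) (n : ℕ) :
    ReesQ.gen a ^ n ∉ maxRees a := by
  intro h
  have h1 : ∀ t ∈ maxRees a, ∀ i, ((ReesQ.equiv ha).symm t).coeff i ∈ maximalIdeal R := by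
    intro t ht
    have h2 : (ReesQ.equiv ha).symm t ∈ (maximalIdeal R).map (C : R →+* R[X]) := by
      have h3 := Ideal.mem_map_of_mem (ReesQ.equiv ha).symm ht
      have h4 : (maxRees a).map (ReesQ.equiv ha).symm = (maximalIdeal R).map (C : R →+* R[X]) := by
        rw [maxRees]
        change Ideal.map ((ReesQ.equiv ha).symm : ReesQ a →+* R[X]) _ = _
        rw [Ideal.map_map]
        congr 1
        ext r : 1
        exact (ReesQ.equiv ha).symm.commutes r
      rwa [h4] at h3
    exact Ideal.mem_map_C_iff.mp h2
  have h5 := h1 _ h n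
  have h6 : (ReesQ.equiv ha).symm (ReesQ.gen a ^ n) = X ^ n := by
    rw [AlgEquiv.symm_apply_eq]
    simp [ReesQ.equiv]
  rw [h6, coeff_X_pow_self] at h5
  exact (Ideal.ne_top_iff_one _).mp (maximalIdeal.isMaximal R).ne_top h5

/-- The rank of the Sally module is the length of its components of large degree. -/
theorem sallyRank_eq_length_component (I : Ideal R) (a : I) (ha : (a : R) ∈ nonZeroDivisors R)
    {n : ℕ} (h : I ^ (n + 1) = Ideal.span {(a : R)} * I ^ n) :
    sallyRank I a = Module.length R (SallyComponent I a n) := by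
  have hp : (maxRees (a : R)).IsPrime := maxRees_isPrime _ fun h => by
    obtain ⟨k, hk⟩ := h
    exact zero_notMem_nonZeroDivisors (hk ▸ pow_mem ha k)
  rw [sallyRank, dif_pos hp]
  let p := maxRees (a : R)
  let A := Localization.AtPrime p
  have hT : Module.Free R (ReesQ (a : R)) := Module.Free.of_basis (ReesQ.basis ha)
  have hflat : Module.Flat R A := Module.Flat.trans R (ReesQ (a : R)) A
  have hmap : (maximalIdeal R).map (algebraMap R A) = maximalIdeal A := by
    rw [IsScalarTower.algebraMap_eq R (ReesQ (a : R)) A, ← Ideal.map_map]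
    exact Localization.AtPrime.map_eq_maximalIdeal
  have hloc : IsLocalHom (algebraMap R A) := by
    refine ((IsLocalRing.local_hom_TFAE (algebraMap R A)).out 0 2).mpr hmap.le
  -- Injectivity survives by exactness of localization; surjectivity holds because `(at)ⁿ` becomes
  -- invertible.
  have hbij : Function.Bijective (LocalizedModule.map p.primeCompl (sallyMap I a n)) := by
    refine ⟨LocalizedModule.map_injective _ _ (sallyMap_injective I a ha n), fun x => ?_⟩
    induction x using LocalizedModule.induction_on with
    | h s t =>
      obtain ⟨z, hz⟩ := exists_sallyMap_eq_gen_pow_smul I a h s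
      refine ⟨LocalizedModule.mk z (⟨_, ReesQ.gen_pow_notMem_maxRees ha n⟩ * t), ?_⟩
      rw [LocalizedModule.map_mk, hz]
      exact LocalizedModule.mk_cancel_common_left
        (⟨_, ReesQ.gen_pow_notMem_maxRees ha n⟩ : p.primeCompl) t s
  have hlen : Module.length A (LocalizedModule p.primeCompl (SallyModule I a)) =
      Module.length A (LocalizedModule p.primeCompl
        (ReesQ (a : R) ⊗[R] SallyComponent I a n)) :=
    (LinearEquiv.length_eq (R := A) (LinearEquiv.ofBijective _ hbij)).symm
  -- Flat local base change multiplies length by `ℓ(A/𝔪A)`, which is one since `𝔪A` is the maximal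
  -- ideal of `A`.
  rw [hlen, (LocalizedModule.equivTensorProduct p.primeCompl _).length_eq,
    (AlgebraTensorModule.cancelBaseChange R (ReesQ (a : R)) A A (SallyComponent I a n)).length_eq,
    IsLocalRing.length_baseChange R A, hmap]
  have : IsSimpleModule A (A ⧸ maximalIdeal A) := by
    rw [isSimpleModule_iff_isCoatom]
    exact (maximalIdeal.isMaximal A).out
  rw [Module.length_eq_one A (A ⧸ maximalIdeal A), mul_one]

end SallyRank

end TwoAGL

/-! ### Additivity of length for subquotients -/

section SubmoduleLength

open IsLocalRing

variable {R : Type*} [CommRing R] {F : Type*} [AddCommGroup F] [Module R F]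

theorem Submodule.inclusion_submoduleOf_le (A : Submodule R F) {B C : Submodule R F} (h : B ≤ C) :
    A.submoduleOf B ≤ (A.submoduleOf C).comap (Submodule.inclusion h) := fun _ hx => hx

theorem Submodule.mapQ_inclusion_injective (A : Submodule R F) {B C : Submodule R F} (h : B ≤ C) :
    Function.Injective (Submodule.mapQ (A.submoduleOf B) (A.submoduleOf C)
      (Submodule.inclusion h) (A.inclusion_submoduleOf_le h)) := by
  rw [injective_iff_map_eq_zero]
  intro x hx
  obtain ⟨x, rfl⟩ := Submodule.Quotient.mk_surjective _ x
  rw [Submodule.mapQ_apply, Submodule.Quotient.mk_eq_zero] at hx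
  exact (Submodule.Quotient.mk_eq_zero _).mpr hx

theorem Submodule.exact_mapQ_inclusion_factor {A B C : Submodule R F} (hAB : A ≤ B) (hBC : B ≤ C) :
    Function.Exact (Submodule.mapQ (A.submoduleOf B) (A.submoduleOf C)
      (Submodule.inclusion hBC) (A.inclusion_submoduleOf_le hBC))
      (Submodule.factor (p := A.submoduleOf C) (p' := B.submoduleOf C)
        (Submodule.comap_mono hAB)) := by
  intro x
  obtain ⟨x, rfl⟩ := Submodule.Quotient.mk_surjective _ x
  constructor
  · intro hx
    have hx' : (x : F) ∈ B := (Submodule.Quotient.mk_eq_zero (B.submoduleOf C)).mp hx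
    exact ⟨Submodule.Quotient.mk ⟨x, hx'⟩, rfl⟩
  · rintro ⟨y, hy⟩
    obtain ⟨y, rfl⟩ := Submodule.Quotient.mk_surjective _ y
    rw [← hy]
    exact (Submodule.Quotient.mk_eq_zero (B.submoduleOf C)).mpr y.2

theorem Module.length_quotient_submoduleOf_add {A B C : Submodule R F} (hAB : A ≤ B)
    (hBC : B ≤ C) :
    Module.length R (C ⧸ A.submoduleOf C) =
      Module.length R (B ⧸ A.submoduleOf B) + Module.length R (C ⧸ B.submoduleOf C) :=
  Module.length_eq_add_of_exact _ _ (A.mapQ_inclusion_injective hBC)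
    (Submodule.factor_surjective _) (Submodule.exact_mapQ_inclusion_factor hAB hBC)

theorem Module.length_quotient_eq_add {A B : Submodule R F} (hAB : A ≤ B) :
    Module.length R (F ⧸ A) = Module.length R (B ⧸ A.submoduleOf B) + Module.length R (F ⧸ B) := by
  refine Module.length_eq_add_of_exact (Submodule.mapQ (A.submoduleOf B) A B.subtype le_rfl)
    (Submodule.factor hAB) ?_ (Submodule.factor_surjective _) ?_
  · rw [injective_iff_map_eq_zero]
    intro x hx
    obtain ⟨x, rfl⟩ := Submodule.Quotient.mk_surjective _ x
    exact (Submodule.Quotient.mk_eq_zero (A.submoduleOf B)).mpr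
      ((Submodule.Quotient.mk_eq_zero A).mp hx)
  · intro x
    obtain ⟨x, rfl⟩ := Submodule.Quotient.mk_surjective _ x
    constructor
    · intro hx
      exact ⟨Submodule.Quotient.mk ⟨x, (Submodule.Quotient.mk_eq_zero B).mp hx⟩, rfl⟩
    · rintro ⟨y, hy⟩
      obtain ⟨y, rfl⟩ := Submodule.Quotient.mk_surjective _ y
      rw [← hy]
      exact (Submodule.Quotient.mk_eq_zero B).mpr y.2

end SubmoduleLength

/-! ### Minimal numbers of generators -/

section MinimalGenerators

open IsLocalRing

variable {R : Type*} [CommRing R] {M N : Type*} [AddCommGroup M] [Module R M]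
  [AddCommGroup N] [Module R N]

theorem TwoAGL.mu_congr (e : M ≃ₗ[R] N) : TwoAGL.mu R M = TwoAGL.mu R N := by
  have h := Submodule.spanFinrank_map_eq_of_injective (e : M →ₗ[R] N) e.injective
    (p := (⊤ : Submodule R M))
  rw [Submodule.map_top, LinearEquiv.range] at h
  exact h.symm

variable [IsLocalRing R]

theorem Module.length_eq_finrank_of_residue_quotient [Module.Finite R M] :
    Module.length R (M ⧸ (maximalIdeal R) • (⊤ : Submodule R M)) =
      Module.finrank (R ⧸ maximalIdeal R) (M ⧸ (maximalIdeal R) • (⊤ : Submodule R M)) := by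
  let : Field (R ⧸ maximalIdeal R) := Ideal.Quotient.field _
  rw [Module.length_eq_of_surjective (R := R ⧸ maximalIdeal R) (S := R)
    Ideal.Quotient.mk_surjective]
  have : Module.Finite (R ⧸ maximalIdeal R) (M ⧸ (maximalIdeal R) • (⊤ : Submodule R M)) :=
    Module.Finite.of_restrictScalars_finite R _ _
  exact Module.length_eq_finrank (R ⧸ maximalIdeal R) _

/-- The minimal number of generators is the length of `M/𝔪M`. -/
theorem TwoAGL.mu_eq_length [Module.Finite R M] :
    (TwoAGL.mu R M : ℕ∞) =
      Module.length R (M ⧸ (maximalIdeal R) • (⊤ : Submodule R M)) := by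
  rw [TwoAGL.mu_congr (Submodule.topEquiv (R := R) (M := M)).symm, TwoAGL.mu,
    Submodule.spanFinrank_top,
    IsLocalRing.spanFinrank_eq_finrank_quotient _ Module.Finite.fg_top,
    ← Module.length_eq_finrank_of_residue_quotient]
  refine (Submodule.Quotient.equiv _ _ Submodule.topEquiv ?_).length_eq
  rw [Submodule.map_smul'', Submodule.map_top, LinearEquiv.range]

/-- Factoring out a minimal generator lowers the number of generators by one. -/
theorem TwoAGL.mu_eq_mu_quotient_add_one [Module.Finite R M] {e : M}
    (he : e ∉ (maximalIdeal R) • (⊤ : Submodule R M)) (f : M →ₗ[R] N)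
    (hf : Function.Surjective f) (hker : LinearMap.ker f = Submodule.span R {e}) :
    TwoAGL.mu R M = TwoAGL.mu R N + 1 := by
  have : Module.Finite R N := Module.Finite.of_surjective f hf
  have hmap : ((maximalIdeal R) • (⊤ : Submodule R M)).map f =
      (maximalIdeal R) • (⊤ : Submodule R N) := by
    rw [Submodule.map_smul'', Submodule.map_top, LinearMap.range_eq_top.mpr hf]
  let g : (M ⧸ (maximalIdeal R) • (⊤ : Submodule R M)) →ₗ[R]
      (N ⧸ (maximalIdeal R) • (⊤ : Submodule R N)) :=
    Submodule.mapQ _ _ f (Submodule.map_le_iff_le_comap.mp hmap.le)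
  -- The sequence `0 → k → M/𝔪M → N/𝔪N → 0` with `1 ↦ e` is exact; injectivity on the left is the
  -- hypothesis `e ∉ 𝔪M`.
  let i : (R ⧸ maximalIdeal R) →ₗ[R] (M ⧸ (maximalIdeal R) • (⊤ : Submodule R M)) :=
    Submodule.liftQ _ (LinearMap.toSpanSingleton R _ (Submodule.Quotient.mk e)) (by
      intro r hr
      rw [LinearMap.mem_ker, LinearMap.toSpanSingleton_apply, ← Submodule.Quotient.mk_smul,
        Submodule.Quotient.mk_eq_zero]
      exact Submodule.smul_mem_smul hr Submodule.mem_top)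
  have hi : ∀ r : R, i (Submodule.Quotient.mk r) = Submodule.Quotient.mk (r • e) := fun _ => rfl
  have hinj : Function.Injective i := by
    rw [injective_iff_map_eq_zero]
    intro x hx
    obtain ⟨r, rfl⟩ := Submodule.Quotient.mk_surjective _ x
    rw [hi, Submodule.Quotient.mk_eq_zero] at hx
    by_contra hr
    have hr' : IsUnit r := by
      by_contra h
      exact hr ((Submodule.Quotient.mk_eq_zero _).mpr ((mem_maximalIdeal r).mpr h))
    exact he ((Submodule.smul_mem_iff_of_isUnit _ hr').mp hx)
  have hsurj : Function.Surjective g := by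
    intro y
    obtain ⟨y, rfl⟩ := Submodule.Quotient.mk_surjective _ y
    obtain ⟨x, rfl⟩ := hf y
    exact ⟨Submodule.Quotient.mk x, rfl⟩
  have hexact : Function.Exact i g := by
    intro x
    obtain ⟨x, rfl⟩ := Submodule.Quotient.mk_surjective _ x
    constructor
    · intro hx
      have hx' : f x ∈ ((maximalIdeal R) • (⊤ : Submodule R M)).map f := by
        rw [hmap]
        exact (Submodule.Quotient.mk_eq_zero _).mp hx
      obtain ⟨z, hz, hzx⟩ := hx'
      have h1 : x - z ∈ LinearMap.ker f := by
        rw [LinearMap.mem_ker, map_sub, hzx, sub_self]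
      rw [hker] at h1
      obtain ⟨r, hr⟩ := Submodule.mem_span_singleton.mp h1
      refine ⟨Submodule.Quotient.mk r, ?_⟩
      rw [hi, hr]
      refine (Submodule.Quotient.eq _).mpr ?_
      have : x - z - x = -z := by abel
      rw [this]
      exact neg_mem hz
    · rintro ⟨r, hr⟩
      obtain ⟨r, rfl⟩ := Submodule.Quotient.mk_surjective _ r
      rw [← hr, hi]
      refine (Submodule.Quotient.mk_eq_zero _).mpr ?_
      have h0 : f e = 0 := LinearMap.mem_ker.mp (hker ▸ Submodule.mem_span_singleton_self e)
      rw [map_smul, h0, smul_zero]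
      exact zero_mem _
  have hsimple : IsSimpleModule R (R ⧸ maximalIdeal R) :=
    isSimpleModule_iff_isCoatom.mpr (maximalIdeal.isMaximal R).out
  have h := Module.length_eq_add_of_exact i g hinj hsurj hexact
  rw [Module.length_eq_one R (R ⧸ maximalIdeal R), ← TwoAGL.mu_eq_length,
    ← TwoAGL.mu_eq_length] at h
  rw [add_comm]
  exact_mod_cast h

/-- As `J ⊆ 𝔪`, the class of `1` lies outside `𝔪(R/J)`, so `(0, 1)` is a minimal generator and can
be factored out. -/
theorem TwoAGL.mu_prod_quotient [Module.Finite R M] {J : Ideal R} (hJ : J ≠ ⊤) :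
    TwoAGL.mu R (M × (R ⧸ J)) = TwoAGL.mu R M + 1 := by
  refine TwoAGL.mu_eq_mu_quotient_add_one (e := (0, 1)) ?_ (LinearMap.fst R M (R ⧸ J))
    LinearMap.fst_surjective ?_
  · intro h
    have h1 := Submodule.mem_map_of_mem (f := LinearMap.snd R M (R ⧸ J)) h
    rw [Submodule.map_smul'', Submodule.map_top,
      LinearMap.range_eq_top.mpr LinearMap.snd_surjective] at h1
    have h2 : (maximalIdeal R) • (⊤ : Submodule R (R ⧸ J)) ≤
        Submodule.map (Submodule.mkQ J) (maximalIdeal R) := by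
      rw [← LinearMap.range_eq_top.mpr (Submodule.mkQ_surjective J), ← Submodule.map_top,
        ← Submodule.map_smul'']
      exact Submodule.map_mono Ideal.mul_le_left
    obtain ⟨r, hr, hr1⟩ := h2 h1
    have hr2 : Ideal.Quotient.mk J r = 1 := hr1
    rw [← map_one (Ideal.Quotient.mk J), Ideal.Quotient.eq] at hr2
    have h3 : r - (r - 1) ∈ maximalIdeal R := sub_mem hr (le_maximalIdeal hJ hr2)
    rw [sub_sub_cancel] at h3
    exact (Ideal.ne_top_iff_one _).mp (maximalIdeal.isMaximal R).ne_top h3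
  · ext ⟨m, q⟩
    obtain ⟨r, rfl⟩ := Ideal.Quotient.mk_surjective q
    simp only [LinearMap.mem_ker, LinearMap.fst_apply, Submodule.mem_span_singleton]
    constructor
    · rintro rfl
      refine ⟨r, Prod.ext (smul_zero r) ?_⟩
      change Ideal.Quotient.mk J (r * 1) = _
      rw [mul_one]
    · rintro ⟨s, hs⟩
      exact (congrArg Prod.fst hs).symm.trans (smul_zero s)

theorem TwoAGL.mu_prod_pi_quotient [Module.Finite R M] {J : Ideal R} (hJ : J ≠ ⊤) (n : ℕ) :
    TwoAGL.mu R (M × (Fin n → R ⧸ J)) = TwoAGL.mu R M + n := by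
  induction n with
  | zero => exact TwoAGL.mu_congr (LinearEquiv.prodUnique (R := R))
  | succ n ih =>
    have e : (M × (Fin (n + 1) → R ⧸ J)) ≃ₗ[R] (M × (Fin n → R ⧸ J)) × (R ⧸ J) :=
      ((LinearEquiv.refl R M).prodCongr ((Fin.consLinearEquiv R (fun _ => R ⧸ J)).symm.trans
        (LinearEquiv.prodComm R _ _))).trans (LinearEquiv.prodAssoc R _ _ _).symm
    rw [TwoAGL.mu_congr e, TwoAGL.mu_prod_quotient hJ, ih, add_assoc]

end MinimalGenerators

namespace TwoAGL

/-! ### Parameters in dimension one -/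

section Parameter

open IsLocalRing CategoryTheory Abelian

variable {R : Type u} [CommRing R] [IsLocalRing R]

theorem IsParameter.mem_maximalIdeal {a : R} (ha : IsParameter a) : a ∈ maximalIdeal R := by
  rw [← ha]
  exact Ideal.le_radical (Ideal.mem_span_singleton_self a)

theorem IsParameter.pow {a : R} (ha : IsParameter a) {n : ℕ} (hn : n ≠ 0) :
    IsParameter (a ^ n) := by
  rw [IsParameter, ← Ideal.span_singleton_pow, Ideal.radical_pow _ hn]
  exact ha

/-- A parameter of a Cohen–Macaulay local ring of dimension one is a non-zero-divisor. -/
theorem IsParameter.mem_nonZeroDivisors (hCM : IsMaximalCohenMacaulay R R)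
    (hdim : ringKrullDim R = 1) {a : R} (ha : IsParameter a) : a ∈ nonZeroDivisors R := by
  obtain ⟨-, rs, hrs, hreg, hlen⟩ := hCM
  rw [hdim] at hlen
  have hlen' : rs.length = 1 := by exact_mod_cast hlen
  obtain ⟨x, rfl⟩ := List.length_eq_one_iff.mp hlen'
  have hx := hrs x (List.mem_singleton_self x)
  rw [← ha] at hx
  -- The regular element `x` of `𝔪` lies in the radical of `(a)`, so some power of it is a multiple
  -- of `a`; a factor of a non-zero-divisor is one too.
  obtain ⟨n, hn⟩ := hx
  obtain ⟨r, hr⟩ := Ideal.mem_span_singleton.mp hn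
  have hx1 : IsSMulRegular R x :=
    ((RingTheory.Sequence.isRegular_cons_iff R x []).mp hreg).1
  have hx2 : x ∈ nonZeroDivisors R :=
    mem_nonZeroDivisors_iff_right.mpr fun z hz => hx1 (by
      change x * z = x * 0
      rw [mul_zero, mul_comm, hz])
  have h := pow_mem hx2 n
  rw [hr] at h
  exact (mul_mem_nonZeroDivisors.mp h).1

/-- If `J` contains a parameter then `R/J` has finite length. -/
theorem IsParameter.isFiniteLength_quotient [IsNoetherianRing R] {b : R} (hb : IsParameter b)
    {J : Ideal R} (hbJ : b ∈ J) : IsFiniteLength R (R ⧸ J) := by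
  have h1 : maximalIdeal R ∈ (Ideal.span {b}).minimalPrimes := by
    have h0 : (Ideal.span {b} : Ideal R) ≤ maximalIdeal R :=
      (Ideal.span_singleton_le_iff_mem _).mpr hb.mem_maximalIdeal
    refine ⟨⟨inferInstance, h0⟩, ?_⟩
    rintro q ⟨hq, hbq⟩ _
    rw [← hb]
    exact hq.radical_le_iff.mpr hbq
  have h2 := IsLocalRing.quotient_artinian_of_mem_minimalPrimes_of_isLocalRing _ h1
  have h3 : IsArtinian R (R ⧸ Ideal.span {b}) :=
    isArtinian_of_surjective_algebraMap (S := R) (R := R ⧸ Ideal.span {b})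
      Ideal.Quotient.mk_surjective
  have h4 : IsFiniteLength R (R ⧸ (Ideal.span {b} : Ideal R)) :=
    isFiniteLength_iff_isNoetherian_isArtinian.mpr ⟨inferInstance, h3⟩
  exact h4.of_surjective (f := Submodule.factor
    ((Ideal.span_singleton_le_iff_mem J).mpr hbJ)) (Submodule.factor_surjective _)

end Parameter

/-! ### Powers of `K`, the ring `S`, and `S/K` -/

section FracK

open IsLocalRing CategoryTheory Abelian

variable {R : Type u} [CommRing R] (F : Type v) [CommRing F] [Algebra R F] [IsFractionRing R F]
  {I : Ideal R} {a : I} (ha : (a : R) ∈ nonZeroDivisors R)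

include ha in
theorem isUnit_algebraMap_parameter : IsUnit (algebraMap R F a) :=
  IsLocalization.map_units F (⟨a, ha⟩ : nonZeroDivisors R)

variable {F}

omit [IsFractionRing R F] in
theorem mem_fracK_iff {y : F} :
    y ∈ fracK F I a ↔ ∃ x ∈ I, algebraMap R F x = algebraMap R F a * y :=
  IsLocalization.mem_coeSubmodule F I

include ha

theorem span_mul_fracK :
    Submodule.span R {algebraMap R F a} * fracK F I a = IsLocalization.coeSubmodule F I := by
  ext y
  rw [Submodule.mem_span_singleton_mul, IsLocalization.mem_coeSubmodule]
  constructor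
  · rintro ⟨z, hz, rfl⟩
    exact mem_fracK_iff.mp hz
  · rintro ⟨x, hx, rfl⟩
    obtain ⟨u, hu⟩ := isUnit_algebraMap_parameter F ha
    have h : algebraMap R F a * (↑u⁻¹ * algebraMap R F x) = algebraMap R F x := by
      rw [← hu, Units.mul_inv_cancel_left]
    exact ⟨_, mem_fracK_iff.mpr ⟨x, hx, h.symm⟩, h⟩

theorem span_pow_mul_fracK_pow (n : ℕ) :
    Submodule.span R {algebraMap R F a ^ n} * fracK F I a ^ n =
      IsLocalization.coeSubmodule F (I ^ n) := by
  induction n with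
  | zero => simp [← Submodule.one_eq_span]
  | succ n ih =>
    rw [pow_succ I, IsLocalization.coeSubmodule_mul, ← ih, ← span_mul_fracK ha, pow_succ, pow_succ,
      mul_mul_mul_comm, Submodule.span_mul_span, Set.singleton_mul_singleton]

theorem mem_fracK_pow_iff {n : ℕ} {y : F} :
    y ∈ fracK F I a ^ n ↔ ∃ x ∈ I ^ n, algebraMap R F x = algebraMap R F a ^ n * y := by
  rw [← IsLocalization.mem_coeSubmodule, ← span_pow_mul_fracK_pow ha,
    Submodule.mem_span_singleton_mul]
  constructor
  · exact fun hy => ⟨y, hy, rfl⟩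
  · rintro ⟨z, hz, h⟩
    rwa [← ((isUnit_algebraMap_parameter F ha).pow n).mul_left_cancel h]

/-- This is the reduction equation divided by `a^{n+1}`, a unit of `F`. -/
theorem fracK_pow_succ_eq {n : ℕ} (h : I ^ (n + 1) = Ideal.span {(a : R)} * I ^ n) :
    fracK F I a ^ (n + 1) = fracK F I a ^ n := by
  refine le_antisymm (fun y hy => ?_) (fun y hy => ?_)
  · obtain ⟨x, hx, hxy⟩ := (mem_fracK_pow_iff ha).mp hy
    rw [h] at hx
    obtain ⟨z, hz, rfl⟩ := Ideal.mem_span_singleton_mul.mp hx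
    refine (mem_fracK_pow_iff ha).mpr ⟨z, hz, ?_⟩
    rw [map_mul, pow_succ', mul_assoc] at hxy
    exact (isUnit_algebraMap_parameter F ha).mul_left_cancel hxy
  · obtain ⟨x, hx, hxy⟩ := (mem_fracK_pow_iff ha).mp hy
    refine (mem_fracK_pow_iff ha).mpr ⟨a * x, ?_, ?_⟩
    · rw [h]; exact Ideal.mul_mem_mul (Ideal.mem_span_singleton_self _) hx
    · rw [map_mul, hxy, pow_succ', mul_assoc]

/-- `S = R[K] = Kⁿ` for large `n`. -/
theorem toSubmodule_ringS_eq {n : ℕ} (h : I ^ (n + 1) = Ideal.span {(a : R)} * I ^ n) :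
    Subalgebra.toSubmodule (ringS F I a) = fracK F I a ^ n := by
  have hs := fracK_pow_succ_eq (F := F) ha h
  have hk : ∀ k, fracK F I a ^ (n + k) = fracK F I a ^ n := by
    intro k
    induction k with
    | zero => rfl
    | succ k ih => rw [← add_assoc, pow_succ, ih, ← pow_succ, hs]
  have hone : (1 : Submodule R F) ≤ fracK F I a ^ n := one_le_pow₀ (one_le_fracK I a)
  refine le_antisymm ?_ ?_
  · let B : Subalgebra R F := (fracK F I a ^ n).toSubalgebra (Submodule.one_le.mp hone) (by
      intro x y hx hy
      rw [← hk n, pow_add]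
      exact Submodule.mul_mem_mul hx hy)
    have hB : ringS F I a ≤ B := Algebra.adjoin_le (by
      intro x hx
      change x ∈ fracK F I a ^ n
      rw [← hs, pow_succ, ← one_mul x]
      exact Submodule.mul_mem_mul (Submodule.one_le.mp hone) hx)
    exact fun x hx => hB hx
  · have h1 := pow_le_pow_left' (fracK_le_ringS (F := F) I a) n
    refine h1.trans ?_
    clear h hs hk hone h1
    induction n with
    | zero => rw [pow_zero]; exact (one_le_fracK I a).trans (fracK_le_ringS I a)
    | succ n ih =>
      rw [pow_succ]
      exact Submodule.mul_le.mpr fun x hx y hy => (ringS F I a).mul_mem (ih hx) hy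

/-- The isomorphism `I ≅ K` given by division by `a`. -/
theorem nonempty_equiv_fracK : Nonempty (I ≃ₗ[R] fracK F I a) := by
  obtain ⟨u, hu⟩ := isUnit_algebraMap_parameter F ha
  let f : I →ₗ[R] fracK F I a :=
    ((LinearMap.mulLeft R (↑u⁻¹ : F)) ∘ₗ (Algebra.linearMap R F) ∘ₗ I.subtype).codRestrict _
      fun x => mem_fracK_iff.mpr ⟨x, x.2, by
        change _ = _ * (↑u⁻¹ * algebraMap R F x)
        rw [← hu, Units.mul_inv_cancel_left]⟩
  have hf : ∀ x, (f x : F) = ↑u⁻¹ * algebraMap R F x := fun _ => rfl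
  refine ⟨LinearEquiv.ofBijective f ⟨fun x y h => ?_, fun y => ?_⟩⟩
  · have h1 := congrArg Subtype.val h
    rw [hf, hf, Units.mul_right_inj] at h1
    exact Subtype.ext (IsFractionRing.injective R F h1)
  · obtain ⟨x, hx, hxy⟩ := mem_fracK_iff.mp y.2
    refine ⟨⟨x, hx⟩, Subtype.ext ?_⟩
    rw [hf, hxy, ← hu, Units.inv_mul_cancel_left]

theorem finite_fracK [IsNoetherianRing R] :
    Module.Finite R (fracK F I a) :=
  let ⟨e⟩ := nonempty_equiv_fracK (F := F) ha
  Module.Finite.equiv e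

theorem finite_ringS [IsNoetherianRing R] {n : ℕ}
    (h : I ^ (n + 1) = Ideal.span {(a : R)} * I ^ n) : Module.Finite R (ringS F I a) := by
  have := finite_fracK (F := F) ha
  have h1 : (Subalgebra.toSubmodule (ringS F I a)).FG := by
    rw [toSubmodule_ringS_eq ha h]
    exact (Module.Finite.iff_fg.mp this).pow n
  exact Module.Finite.iff_fg.mpr h1

/-- The length of the large-degree components of the Sally module is the length of `S/K`. -/
theorem length_sallyComponent {n : ℕ} (h : I ^ (n + 1) = Ideal.span {(a : R)} * I ^ n) :
    Module.length R (SallyComponent I a n) = Module.length R (SModK F I a) := by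
  have hS : Subalgebra.toSubmodule (ringS F I a) = fracK F I a ^ (n + 1) := by
    rw [toSubmodule_ringS_eq ha h, fracK_pow_succ_eq ha h]
  -- Division by `a^{n+1}` sends `I^{n+1}` onto `K^{n+1} = S` and `IQⁿ = aⁿI` onto `I/a = K`.
  obtain ⟨u, hu⟩ := (isUnit_algebraMap_parameter F ha).pow (n + 1)
  let f : ↥(I ^ (n + 1)) →ₗ[R] Subalgebra.toSubmodule (ringS F I a) :=
    ((LinearMap.mulLeft R (↑u⁻¹ : F)) ∘ₗ (Algebra.linearMap R F) ∘ₗ (I ^ (n + 1)).subtype).codRestrict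
      _ fun x => by
        rw [hS]
        refine (mem_fracK_pow_iff ha).mpr ⟨x, x.2, ?_⟩
        change _ = _ * (↑u⁻¹ * algebraMap R F x)
        rw [← hu, Units.mul_inv_cancel_left]
  have hf : ∀ x, (f x : F) = ↑u⁻¹ * algebraMap R F x := fun _ => rfl
  have hbij : Function.Bijective f := by
    refine ⟨fun x y h => ?_, fun y => ?_⟩
    · have h1 := congrArg Subtype.val h
      rw [hf, hf, Units.mul_right_inj] at h1
      exact Subtype.ext (IsFractionRing.injective R F h1)
    · obtain ⟨x, hx, hxy⟩ := (mem_fracK_pow_iff ha).mp (hS.le y.2)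
      refine ⟨⟨x, hx⟩, Subtype.ext ?_⟩
      rw [hf, hxy, ← hu, Units.inv_mul_cancel_left]
  refine (Submodule.Quotient.equiv _ _ (LinearEquiv.ofBijective f hbij) ?_).length_eq
  have hmem : ∀ x : ↥(I ^ (n + 1)), f x ∈ (fracK F I a).submoduleOf
      (Subalgebra.toSubmodule (ringS F I a)) ↔
        x ∈ (I * Ideal.span {(a : R)} ^ n).submoduleOf (I ^ (n + 1)) := by
    intro x
    have h1 : f x ∈ (fracK F I a).submoduleOf (Subalgebra.toSubmodule (ringS F I a)) ↔
      (f x : F) ∈ fracK F I a := Iff.rfl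
    have h2 : x ∈ (I * Ideal.span {(a : R)} ^ n).submoduleOf (I ^ (n + 1)) ↔
      (x : R) ∈ I * Ideal.span {(a : R)} ^ n := Iff.rfl
    have h3 : algebraMap R F a ^ n * (algebraMap R F a * (f x : F)) = algebraMap R F x := by
      rw [hf, ← mul_assoc, ← pow_succ, ← hu, Units.mul_inv_cancel_left]
    rw [h1, h2, mem_fracK_iff, Ideal.span_singleton_pow, mul_comm I, Ideal.mem_span_singleton_mul]
    refine exists_congr fun z => and_congr_right fun _ => ?_
    rw [← ((isUnit_algebraMap_parameter F ha).pow n).mul_right_inj, h3, ← map_pow, ← map_mul]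
    exact (IsFractionRing.injective R F).eq_iff
  refine le_antisymm ?_ ?_
  · rw [Submodule.map_le_iff_le_comap]
    exact fun x hx => (hmem x).mpr hx
  · intro y hy
    obtain ⟨x, rfl⟩ := hbij.2 y
    exact ⟨x, (hmem x).mp hy, rfl⟩

end FracK

/-! ### Canonical duality for fractional ideals -/

section Duality

open IsLocalRing CategoryTheory Abelian

variable {R : Type u} [CommRing R] (F : Type v) [CommRing F] [Algebra R F]

theorem exists_coeSubmodule_eq {N : Submodule R F} (hN : N ≤ 1) :
    ∃ J : Ideal R, IsLocalization.coeSubmodule F J = N := by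
  refine ⟨N.comap (Algebra.linearMap R F), ?_⟩
  rw [IsLocalization.coeSubmodule, Submodule.map_comap_eq, inf_eq_right]
  rwa [Submodule.one_eq_range] at hN

/-- In effect `N : uA = u⁻¹(N : A)`. With `u = a` and `aK = I`, it turns colons by `K` into colons
by ideals of `R`, to which duality applies. -/
theorem colon_smul_unit_mem_iff (u : Fˣ) (N A : Submodule R F) (y : F) :
    y ∈ N / (Submodule.span R {(u : F)} * A) ↔ u * y ∈ N / A := by
  simp only [Submodule.mem_div_iff_forall_mul_mem]
  constructor
  · intro h z hz
    have := h (u * z) (Submodule.mul_mem_mul (Submodule.mem_span_singleton_self _) hz)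
    rwa [mul_left_comm, ← mul_assoc] at this
  · intro h z hz
    obtain ⟨w, hw, rfl⟩ := Submodule.mem_span_singleton_mul.mp hz
    have := h w hw
    rwa [mul_left_comm, ← mul_assoc]

/-- Multiplication by a unit of `F` induces isomorphisms of subquotients. -/
theorem length_quotient_submoduleOf_of_unit (u : Fˣ) {A B A' B' : Submodule R F}
    (hA : ∀ y, y ∈ A ↔ u * y ∈ A') (hB : ∀ y, y ∈ B ↔ u * y ∈ B') :
    Module.length R (B ⧸ A.submoduleOf B) = Module.length R (B' ⧸ A'.submoduleOf B') := by
  let e : B ≃ₗ[R] B' := LinearEquiv.ofBijective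
    (((LinearMap.mulLeft R (u : F)) ∘ₗ B.subtype).codRestrict B' fun y => (hB y).mp y.2) (by
      refine ⟨fun y z h => Subtype.ext ?_, fun y => ?_⟩
      · exact (Units.mul_right_inj u).mp (congrArg Subtype.val h)
      · have hy : (u : F) * (↑u⁻¹ * y) = y := Units.mul_inv_cancel_left u _
        exact ⟨⟨((u⁻¹ : Fˣ) : F) * y, (hB _).mpr (hy.symm ▸ y.2)⟩, Subtype.ext hy⟩)
  refine (Submodule.Quotient.equiv _ _ e (le_antisymm ?_ ?_)).length_eq
  · rw [Submodule.map_le_iff_le_comap]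
    exact fun y hy => (hA _).mp hy
  · intro z hz
    obtain ⟨y, rfl⟩ := e.surjective z
    exact ⟨y, (hA _).mpr hz, rfl⟩

variable [IsFractionRing R F] [IsLocalRing R]

/-- The type of `R` is the length of `(R : 𝔪)/R`. -/
theorem cmType_self_eq_length {a : R} (ha : a ∈ nonZeroDivisors R) (ham : a ∈ maximalIdeal R) :
    cmType R R = Module.length R
      (↥((1 : Submodule R F) / IsLocalization.coeSubmodule F (maximalIdeal R)) ⧸
        (1 : Submodule R F).submoduleOf
          (1 / IsLocalization.coeSubmodule F (maximalIdeal R))) := by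
  let e : R ≃ₗ[R] (1 : Submodule R F) :=
    (LinearEquiv.ofInjective (Algebra.linearMap R F) (IsFractionRing.injective R F)).trans
      (LinearEquiv.ofEq _ _ Submodule.one_eq_range.symm)
  obtain ⟨α⟩ := nonempty_ext_one_quotient_equiv (F := F) e ha ham
  exact α.length_eq.symm

variable [IsNoetherianRing R] {F}
  {I : Ideal R} {a : I} (ha : (a : R) ∈ nonZeroDivisors R) (hap : IsParameter (a : R))
  (hI : IsCanonicalIdeal I)

include ha hap hI

/-- Duality: `ℓ((K : J)/K) = ℓ(R/J)`. -/
theorem length_fracK_colon {J : Ideal R} {n : ℕ} (hn : n ≠ 0) (hJ : (a : R) ^ n ∈ J) :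
    Module.length R (↥(fracK F I a / IsLocalization.coeSubmodule F J) ⧸
      (fracK F I a).submoduleOf (fracK F I a / IsLocalization.coeSubmodule F J)) =
    Module.length R (R ⧸ J) := by
  obtain ⟨e⟩ := nonempty_equiv_fracK (F := F) ha
  obtain ⟨d, hd⟩ := hI.2.finite_injectiveDimension
  exact length_colon_quotient e ha hap.mem_maximalIdeal
    (hap.isFiniteLength_quotient (Ideal.mem_span_singleton_self _)) hd hI.2.cmType_eq_one
    (pow_mem ha n) hJ ((hap.pow hn).isFiniteLength_quotient hJ)

/-- `K : K = R`. -/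
theorem fracK_div_self : fracK F I a / fracK F I a = 1 := by
  obtain ⟨u, hu⟩ := isUnit_algebraMap_parameter F ha
  set B := fracK F I a / fracK F I a with hB
  have h1B : (1 : Submodule R F) ≤ B := by
    rw [hB, Submodule.le_div_iff_mul_le, one_mul]
  have hBK : B ≤ fracK F I a := fun y hy => by
    have := Submodule.mem_div_iff_forall_mul_mem.mp hy 1
      (one_le_fracK I a (Submodule.one_le.mp le_rfl))
    rwa [mul_one] at this
  -- `aB ⊆ aK = I ⊆ R`, so `J = aB` is an ideal containing `(a)`, and the claim becomes `J = (a)`.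
  have hle : Submodule.span R {(u : F)} * B ≤ 1 := by
    rw [hu]
    refine (mul_le_mul_right hBK _).trans ?_
    rw [span_mul_fracK ha, ← IsLocalization.coeSubmodule_top]
    exact IsLocalization.coeSubmodule_mono F le_top
  obtain ⟨J, hJ⟩ := exists_coeSubmodule_eq F hle
  have haJ : Ideal.span {(a : R)} ≤ J := by
    rw [← IsLocalization.coeSubmodule_le_coeSubmodule (S := F) le_rfl, hJ,
      IsLocalization.coeSubmodule_span_singleton, ← hu]
    calc _ = Submodule.span R {(u : F)} * 1 := (mul_one _).symm
      _ ≤ _ := mul_le_mul_right h1B _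
  -- Both sides are `a⁻¹K`, since `K : B = K` by `1 ∈ B` and `BK ⊆ K`. Duality then makes `R/J` and
  -- `R/(a)` of equal finite length.
  have hcolon : fracK F I a / IsLocalization.coeSubmodule F (Ideal.span {(a : R)}) =
      fracK F I a / IsLocalization.coeSubmodule F J := by
    ext y
    rw [hJ, IsLocalization.coeSubmodule_span_singleton, ← hu,
      ← mul_one (Submodule.span R {(u : F)}), colon_smul_unit_mem_iff, mul_one,
      colon_smul_unit_mem_iff]
    simp only [Submodule.mem_div_iff_forall_mul_mem]
    constructor
    · intro h b hb
      have h1 := h 1 (Submodule.one_le.mp le_rfl)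
      rw [mul_one] at h1
      rw [mul_comm]
      exact Submodule.mem_div_iff_forall_mul_mem.mp hb _ h1
    · intro h b hb
      exact h b (h1B hb)
  have hlen := length_fracK_colon (F := F) ha hap hI (J := Ideal.span {(a : R)}) one_ne_zero
    (by rw [pow_one]; exact Ideal.mem_span_singleton_self _)
  have hlen' := length_fracK_colon (F := F) ha hap hI (J := J) one_ne_zero
    (by rw [pow_one]; exact haJ (Ideal.mem_span_singleton_self _))
  rw [hcolon, hlen'] at hlen
  have hJa : J = Ideal.span {(a : R)} := by
    refine le_antisymm ?_ haJ
    have hfin := hap.isFiniteLength_quotient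
      (Ideal.mem_span_singleton_self (a : R))
    obtain ⟨_, _⟩ := isFiniteLength_iff_isNoetherian_isArtinian.mp hfin
    have h1 : Submodule.map (Submodule.mkQ (Ideal.span {(a : R)})) J = ⊥ := by
      by_contra hne
      have h2 := Submodule.length_quotient_lt _ hne
      rw [(Submodule.quotientQuotientEquivQuotient _ _ haJ).length_eq, hlen] at h2
      exact lt_irrefl _ h2
    rwa [← le_bot_iff, Submodule.map_le_iff_le_comap, Submodule.comap_bot,
      Submodule.ker_mkQ] at h1
  refine le_antisymm (fun y hy => ?_) h1B
  have h2 : (u : F) * y ∈ IsLocalization.coeSubmodule F J := by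
    rw [hJ]
    exact Submodule.mul_mem_mul (Submodule.mem_span_singleton_self _) hy
  rw [hJa, IsLocalization.mem_coeSubmodule] at h2
  obtain ⟨x, hx, hxy⟩ := h2
  obtain ⟨z, rfl⟩ := Ideal.mem_span_singleton'.mp hx
  rw [map_mul, ← hu, mul_comm, Units.mul_right_inj] at hxy
  exact Submodule.mem_one.mpr ⟨z, hxy⟩

/-- The type of `R` is the minimal number of generators of the canonical module. -/
theorem cmType_self_eq_mu_fracK : cmType R R = mu R (fracK F I a) := by
  obtain ⟨u, hu⟩ := isUnit_algebraMap_parameter F ha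
  obtain ⟨e⟩ := nonempty_equiv_fracK (F := F) ha
  rw [← mu_congr e, mu_eq_length]
  have ham := hap.mem_maximalIdeal
  let m := maximalIdeal R
  have hIF : IsLocalization.coeSubmodule F I = Submodule.span R {(u : F)} * fracK F I a := by
    rw [hu, span_mul_fracK ha]
  -- `K : I = a⁻¹(K : K) = a⁻¹R` and `K : I𝔪 = a⁻¹(R : 𝔪)`, so `(R:𝔪)/R` is isomorphic to
  -- `(K:I𝔪)/(K:I)`.
  have hKI : ∀ y, y ∈ fracK F I a / IsLocalization.coeSubmodule F I ↔
      (u : F) * y ∈ (1 : Submodule R F) := by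
    intro y
    rw [hIF, colon_smul_unit_mem_iff, fracK_div_self ha hap hI]
  have hKmI : ∀ y, y ∈ fracK F I a / IsLocalization.coeSubmodule F (I * m) ↔
      (u : F) * y ∈ 1 / IsLocalization.coeSubmodule F m := by
    intro y
    rw [IsLocalization.coeSubmodule_mul, hIF, mul_assoc, colon_smul_unit_mem_iff,
      ← fracK_div_self (F := F) ha hap hI]
    simp only [Submodule.mem_div_iff_forall_mul_mem]
    constructor
    · intro h z hz k hk
      rw [mul_assoc, mul_comm z]
      exact h _ (Submodule.mul_mem_mul hk hz)
    · intro h z hz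
      induction hz using Submodule.mul_induction_on' with
      | mem_mul_mem k hk z hz =>
        rw [mul_comm k, ← mul_assoc]
        exact h z hz k hk
      | add x _ y _ hx hy => rw [mul_add]; exact add_mem hx hy
  rw [cmType_self_eq_length F ha ham, ← length_quotient_submoduleOf_of_unit F u hKI hKmI]
  have h1 := length_fracK_colon (F := F) ha hap hI (J := I) one_ne_zero
    (by rw [pow_one]; exact a.2)
  -- The square is needed here: `a ∈ I ∩ 𝔪` puts `a²` in `I𝔪`.
  have h2 := length_fracK_colon (F := F) ha hap hI (J := I * m) two_ne_zero
    (by rw [pow_two]; exact Ideal.mul_mem_mul a.2 ham)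
  have hle1 : fracK F I a ≤ fracK F I a / IsLocalization.coeSubmodule F I := by
    rw [Submodule.le_div_iff_mul_le]
    calc _ ≤ fracK F I a * 1 := mul_le_mul_right (by
          rw [← IsLocalization.coeSubmodule_top]
          exact IsLocalization.coeSubmodule_mono F le_top) _
      _ = _ := mul_one _
  have hle2 : fracK F I a / IsLocalization.coeSubmodule F I ≤
      fracK F I a / IsLocalization.coeSubmodule F (I * m) := by
    intro y hy
    rw [Submodule.mem_div_iff_forall_mul_mem] at hy ⊢
    exact fun z hz => hy z (IsLocalization.coeSubmodule_mono F Ideal.mul_le_left hz)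
  -- By duality the length sought is `ℓ(R/I𝔪) - ℓ(R/I) = ℓ(I/𝔪I)`.
  have h3 := Module.length_quotient_submoduleOf_add hle1 hle2
  have h4 : Module.length R (R ⧸ I * m) =
      Module.length R (I ⧸ m • (⊤ : Submodule R I)) + Module.length R (R ⧸ I) := by
    have hsub : Submodule.submoduleOf (I * m) I = m • (⊤ : Submodule R I) := by
      refine Submodule.map_injective_of_injective I.subtype_injective ?_
      rw [Submodule.submoduleOf, Submodule.map_comap_subtype, Submodule.map_smul'',
        Submodule.map_top, Submodule.range_subtype, inf_eq_right.mpr Ideal.mul_le_left, mul_comm]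
      rfl
    rw [Module.length_quotient_eq_add (A := I * m) (B := I) Ideal.mul_le_left, hsub]
  rw [h1, h2, h4, add_comm] at h3
  have hfin : Module.length R (R ⧸ I) ≠ ⊤ := Module.length_ne_top_iff.mpr
    (hap.isFiniteLength_quotient a.2)
  exact ((ENat.addLECancellable_of_ne_top hfin).inj.mp h3).symm

/-- `ℓ((K : 𝔪)/K) = 1`. -/
theorem length_fracK_colon_maximalIdeal :
    Module.length R (↥(fracK F I a / IsLocalization.coeSubmodule F (maximalIdeal R)) ⧸
      (fracK F I a).submoduleOf
        (fracK F I a / IsLocalization.coeSubmodule F (maximalIdeal R))) = 1 := by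
  rw [length_fracK_colon ha hap hI one_ne_zero (by rw [pow_one]; exact hap.mem_maximalIdeal)]
  have : IsSimpleModule R (R ⧸ maximalIdeal R) :=
    isSimpleModule_iff_isCoatom.mpr (maximalIdeal.isMaximal R).out
  exact Module.length_eq_one R (R ⧸ maximalIdeal R)

end Duality

end TwoAGL

/-! ### Modules over a local ring with principal maximal ideal of square zero -/

section LengthTwoRing

variable {A : Type*} [CommRing A] {M : Type*} [AddCommGroup M] [Module A M]

/-- A finite module killed by a maximal ideal is a vector space over the residue field. -/
theorem Module.exists_equiv_pi_quotient_of_isTorsionBySet {p : Ideal A} [hp : p.IsMaximal]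
    [Module.Finite A M] (h : Module.IsTorsionBySet A M p) :
    ∃ n : ℕ, Nonempty (M ≃ₗ[A] (Fin n → A ⧸ p)) := by
  let : Module (A ⧸ p) M := h.module
  have : IsScalarTower A (A ⧸ p) M := h.isScalarTower
  let : Field (A ⧸ p) := Ideal.Quotient.field p
  have : Module.Finite (A ⧸ p) M := Module.Finite.of_restrictScalars_finite A _ _
  exact ⟨_, ⟨(Module.finBasis (A ⧸ p) M).equivFun.restrictScalars A⟩⟩

/-- The structure of finite modules over a ring of length two with principal maximal ideal. -/
theorem Module.exists_equiv_prod_pi_of_sq_eq_zero {p : Ideal A} [hp : p.IsMaximal] {x : A}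
    (hpx : p = Ideal.span {x}) (hx2 : x * x = 0) (hx : x ≠ 0) [IsNoetherian A M] :
    ∃ l m : ℕ, Nonempty (M ≃ₗ[A] ((Fin l → A) × (Fin m → A ⧸ p))) := by
  have hxp : x ∈ p := hpx ▸ Ideal.mem_span_singleton_self x
  have hann : ∀ r : A, r * x = 0 → r ∈ p := by
    intro r hr
    by_contra hrp
    obtain ⟨s, t, ht, hst⟩ := hp.exists_inv hrp
    refine hx ?_
    rw [hpx] at ht
    obtain ⟨w, rfl⟩ := Ideal.mem_span_singleton'.mp ht
    calc x = (s * r + w * x) * x := by rw [hst, one_mul]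
      _ = s * (r * x) + w * (x * x) := by ring
      _ = 0 := by rw [hr, hx2]; ring
  have hp_exists : ∀ r ∈ p, ∃ b, b * x = r := fun r hr =>
    Ideal.mem_span_singleton'.mp (hpx ▸ hr)
  let μ : M →ₗ[A] M := LinearMap.lsmul A M x
  have hμ : ∀ z, μ z = x • z := fun _ => rfl
  -- `V = xM ⊆ Z = ker x` are both vector spaces over `A/p`. A complement `W` of `V` in `Z` will be
  -- the vector space part, and lifts along `x` of a basis of `V` a basis of the free part.
  let Z : Submodule A M := LinearMap.ker μ
  let V : Submodule A M := LinearMap.range μ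
  have hVZ : V ≤ Z := by
    rintro _ ⟨z, rfl⟩
    rw [LinearMap.mem_ker, hμ, hμ, smul_smul, hx2, zero_smul]
  have hZx : ∀ z ∈ Z, x • z = 0 := fun z hz => hz
  have htors : ∀ N : Submodule A M, N ≤ Z → Module.IsTorsionBySet A N p := by
    rintro N hN ⟨z, hz⟩ ⟨r, hr⟩
    obtain ⟨b, rfl⟩ := hp_exists r hr
    refine Subtype.ext ?_
    change (b * x) • z = 0
    rw [mul_smul, hZx z (hN hz), smul_zero]
  obtain ⟨l, ⟨eV⟩⟩ := Module.exists_equiv_pi_quotient_of_isTorsionBySet (htors V hVZ)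
  obtain ⟨k, ⟨eZ⟩⟩ := Module.exists_equiv_pi_quotient_of_isTorsionBySet (htors Z le_rfl)
  have hsimple : IsSimpleModule A (A ⧸ p) := isSimpleModule_iff_isCoatom.mpr hp.out
  have hss : IsSemisimpleModule A Z := IsSemisimpleModule.congr eZ
  obtain ⟨W', hW'⟩ := exists_isCompl (V.submoduleOf Z)
  let W : Submodule A M := W'.map Z.subtype
  have hWZ : W ≤ Z := Submodule.map_subtype_le Z W'
  have hdisj : ∀ z ∈ V, z ∈ W → z = 0 := by
    rintro _ hzV ⟨z, hz, rfl⟩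
    have : z ∈ V.submoduleOf Z ⊓ W' := ⟨hzV, hz⟩
    rw [hW'.inf_eq_bot, Submodule.mem_bot] at this
    rw [this, map_zero]
  have hsum : ∀ z ∈ Z, ∃ v ∈ V, ∃ w ∈ W, v + w = z := by
    intro z hz
    have : (⟨z, hz⟩ : Z) ∈ V.submoduleOf Z ⊔ W' := by
      rw [hW'.sup_eq_top]; exact Submodule.mem_top
    obtain ⟨v, hv, w, hw, hvw⟩ := Submodule.mem_sup.mp this
    exact ⟨v, hv, w, ⟨w, hw, rfl⟩, congrArg Subtype.val hvw⟩
  obtain ⟨m, ⟨eW⟩⟩ := Module.exists_equiv_pi_quotient_of_isTorsionBySet (htors W hWZ)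
  have hy : ∀ i : Fin l, ∃ y : M, x • y = eV.symm (Pi.single i 1) := fun i =>
    (eV.symm (Pi.single i 1)).2
  choose y hy using hy
  have hcomb : ∀ c : Fin l → A, x • ∑ i, c i • y i =
      eV.symm (fun i => Ideal.Quotient.mk p (c i)) := by
    intro c
    have h1 : (fun i => Ideal.Quotient.mk p (c i)) =
        ∑ i, c i • (Pi.single i 1 : Fin l → A ⧸ p) := by
      rw [pi_eq_sum_univ' (fun i => Ideal.Quotient.mk p (c i))]
      refine Finset.sum_congr rfl fun i _ => ?_
      ext j
      by_cases hij : j = i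
      · subst hij; simp [Algebra.smul_def]
      · simp [hij]
    rw [h1, map_sum, AddSubmonoidClass.coe_finsetSum, Finset.smul_sum]
    refine Finset.sum_congr rfl fun i _ => ?_
    rw [map_smul, smul_comm, hy]
    rfl
  let φ : ((Fin l → A) × W) →ₗ[A] M := (Fintype.linearCombination A y).coprod W.subtype
  have hφ : ∀ c w, φ (c, w) = ∑ i, c i • y i + (w : M) := by
    intro c w
    simp [φ, Fintype.linearCombination_apply]
  have hinj : Function.Injective φ := by
    rw [injective_iff_map_eq_zero]
    rintro ⟨c, w⟩ h
    rw [hφ] at h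
    have h1 : (eV.symm (fun i => Ideal.Quotient.mk p (c i)) : M) = 0 := by
      rw [← hcomb, eq_neg_of_add_eq_zero_left h, smul_neg, hZx _ (hWZ w.2), neg_zero]
    have h2 : (fun i => Ideal.Quotient.mk p (c i)) = 0 :=
      eV.symm.map_eq_zero_iff.mp (Subtype.ext h1)
    have h3 : ∀ i, c i ∈ p := fun i => Ideal.Quotient.eq_zero_iff_mem.mp (congrFun h2 i)
    choose b hb using fun i => hp_exists (c i) (h3 i)
    have h4 : ∑ i, c i • y i = x • ∑ i, b i • y i := by
      rw [Finset.smul_sum]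
      refine Finset.sum_congr rfl fun i _ => ?_
      rw [← hb i, mul_comm, mul_smul]
    have h5 : (w : M) = 0 := by
      refine hdisj _ ?_ w.2
      rw [eq_neg_of_add_eq_zero_right h, h4]
      exact neg_mem ⟨_, rfl⟩
    rw [h5, add_zero, h4, hcomb] at h
    have h6 : (fun i => Ideal.Quotient.mk p (b i)) = 0 :=
      eV.symm.map_eq_zero_iff.mp (Subtype.ext h)
    refine Prod.ext (funext fun i => ?_) (Subtype.ext h5)
    obtain ⟨d, hd⟩ := hp_exists (b i) (Ideal.Quotient.eq_zero_iff_mem.mp (congrFun h6 i))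
    change c i = 0
    rw [← hb i, ← hd, mul_assoc, hx2, mul_zero]
  have hsurj : Function.Surjective φ := by
    intro z
    have hlift : ∀ v ∈ V, ∃ c : Fin l → A, x • ∑ i, c i • y i = v := by
      intro v hv
      choose c hc using fun i => Ideal.Quotient.mk_surjective (I := p) (eV ⟨v, hv⟩ i)
      refine ⟨c, ?_⟩
      rw [hcomb, funext hc, LinearEquiv.symm_apply_apply]
    obtain ⟨c, hc⟩ := hlift (x • z) ⟨z, rfl⟩
    have hz : z - ∑ i, c i • y i ∈ Z := by
      rw [LinearMap.mem_ker, hμ, smul_sub, hc, sub_self]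
    obtain ⟨v, hv, w, hw, hvw⟩ := hsum _ hz
    obtain ⟨b, hb⟩ := hlift v hv
    -- `c` matches `z` after multiplication by `x`; `x • b` supplies the component in `V` of the
    -- remaining error in `Z`.
    refine ⟨(c + x • b, ⟨w, hw⟩), ?_⟩
    rw [hφ]
    simp only [Pi.add_apply, Pi.smul_apply, smul_eq_mul, add_smul, mul_smul,
      Finset.sum_add_distrib]
    rw [← Finset.smul_sum, hb, add_assoc, hvw]
    abel
  exact ⟨l, m, ⟨(LinearEquiv.ofBijective φ ⟨hinj, hsurj⟩).symm.trans
    ((LinearEquiv.refl A _).prodCongr eW)⟩⟩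

end LengthTwoRing

namespace TwoAGL

/-! ### Ideals of colength two -/

section ColengthTwo

open IsLocalRing

variable {R : Type u} [CommRing R] [IsLocalRing R]

theorem isSimpleModule_residue : IsSimpleModule R (R ⧸ maximalIdeal R) :=
  isSimpleModule_iff_isCoatom.mpr (maximalIdeal.isMaximal R).out

/-- Modules of length at most one over a local ring are killed by the maximal ideal. -/
theorem smul_eq_zero_of_length_le_one {M : Type*} [AddCommGroup M] [Module R M]
    (h : Module.length R M ≤ 1) {r : R} (hr : r ∈ maximalIdeal R) (x : M) : r • x = 0 := by
  rcases eq_or_ne x 0 with rfl | hx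
  · exact smul_zero r
  have : Nontrivial M := ⟨x, 0, hx⟩
  have h1 : IsSimpleModule R M := Module.length_eq_one_iff.mp
    (le_antisymm h (Order.one_le_iff_pos.mpr Module.length_pos))
  obtain ⟨m, hm, ⟨e⟩⟩ := isSimpleModule_iff_quot_maximal.mp h1
  obtain rfl := eq_maximalIdeal hm
  apply e.injective
  rw [map_smul, map_zero]
  obtain ⟨s, hs⟩ := Ideal.Quotient.mk_surjective (e x)
  rw [← hs]
  exact Ideal.Quotient.eq_zero_iff_mem.mpr (Ideal.mul_mem_right s _ hr)

theorem le_maximalIdeal_of_length_two {c : Ideal R} (hc : Module.length R (R ⧸ c) = 2) :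
    c ≤ maximalIdeal R := by
  refine le_maximalIdeal ?_
  rintro rfl
  rw [Module.length_eq_zero (R := R) (M := R ⧸ (⊤ : Ideal R))] at hc
  exact absurd hc (by norm_num)

theorem length_maximalIdeal_quotient {c : Ideal R} (hc : Module.length R (R ⧸ c) = 2) :
    Module.length R (maximalIdeal R ⧸ Submodule.submoduleOf c (maximalIdeal R)) = 1 := by
  have h := Module.length_quotient_eq_add (le_maximalIdeal_of_length_two hc)
  have := isSimpleModule_residue (R := R)
  rw [hc, Module.length_eq_one R (R ⧸ maximalIdeal R), ← one_add_one_eq_two,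
    add_comm (Module.length R _)] at h
  exact ((ENat.addLECancellable_of_ne_top ENat.one_ne_top).inj.mp h).symm

/-- In a local ring, `𝔪² ⊆ 𝔠` for every ideal `𝔠` of colength two. -/
theorem mul_mem_of_length_two {c : Ideal R} (hc : Module.length R (R ⧸ c) = 2) {r s : R}
    (hr : r ∈ maximalIdeal R) (hs : s ∈ maximalIdeal R) : r * s ∈ c :=
  (Submodule.Quotient.mk_eq_zero (Submodule.submoduleOf c (maximalIdeal R))).mp
    (smul_eq_zero_of_length_le_one (length_maximalIdeal_quotient hc).le hr
      (Submodule.Quotient.mk ⟨s, hs⟩))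

/-- `𝔪/𝔠` is simple, so any element of `𝔪` outside `𝔠` generates it. -/
theorem exists_span_sup_eq_of_length_two {c : Ideal R} (hc : Module.length R (R ⧸ c) = 2) :
    ∃ x ∈ maximalIdeal R, x ∉ c ∧ Ideal.span {x} ⊔ c = maximalIdeal R := by
  have h1 := length_maximalIdeal_quotient hc
  have h2 : IsSimpleModule R (maximalIdeal R ⧸ Submodule.submoduleOf c (maximalIdeal R)) :=
    Module.length_eq_one_iff.mp h1
  have := IsSimpleModule.nontrivial R
    (maximalIdeal R ⧸ Submodule.submoduleOf c (maximalIdeal R))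
  obtain ⟨q, hq⟩ := exists_ne
    (0 : maximalIdeal R ⧸ Submodule.submoduleOf c (maximalIdeal R))
  obtain ⟨x, rfl⟩ := Submodule.Quotient.mk_surjective _ q
  have hxc : (x : R) ∉ c := fun h => hq ((Submodule.Quotient.mk_eq_zero _).mpr h)
  refine ⟨x, x.2, hxc, le_antisymm (sup_le ?_ (le_maximalIdeal_of_length_two hc)) fun y hy => ?_⟩
  · exact (Ideal.span_singleton_le_iff_mem _).mpr x.2
  · obtain ⟨r, hr⟩ := IsSimpleModule.toSpanSingleton_surjective R hq
      (Submodule.Quotient.mk ⟨y, hy⟩)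
    have h3 : r * x - y ∈ c :=
      (Submodule.Quotient.eq (Submodule.submoduleOf c (maximalIdeal R))
        (x := r • x) (y := ⟨y, hy⟩)).mp hr
    have h4 : y = r * x + -(r * x - y) := by ring
    rw [h4]
    exact Submodule.add_mem_sup (Ideal.mul_mem_left _ r (Ideal.mem_span_singleton_self _))
      (neg_mem h3)

/-- The shape of an ideal of colength two in a Noetherian local ring. -/
theorem exists_isMinimalGenerators_of_length_two [IsNoetherianRing R] {c : Ideal R}
    (hc : Module.length R (R ⧸ c) = 2) :
    ∃ (n : ℕ) (x : Fin (n + 1) → R), IsMinimalGenerators (maximalIdeal R) x ∧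
      c = Ideal.span {x 0 ^ 2} ⊔ Ideal.span (Set.range fun i : Fin n => x i.succ) := by
  classical
  obtain ⟨x, hxm, hxc, hx⟩ := exists_span_sup_eq_of_length_two hc
  -- Taking the least number of elements of `𝔠` that generate `𝔪` together with `x` makes each of
  -- them indispensable; `x` is indispensable because the others lie in `𝔠 ≠ 𝔪`.
  have hex : ∃ n : ℕ, ∃ y : Fin n → R, (∀ i, y i ∈ c) ∧
      Ideal.span {x} ⊔ Ideal.span (Set.range y) = maximalIdeal R := by
    obtain ⟨n, y, hy⟩ := Submodule.fg_iff_exists_fin_generating_family.mp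
      (IsNoetherian.noetherian c)
    have hy' : Ideal.span (Set.range y) = c := hy
    exact ⟨n, y, fun i => hy' ▸ Ideal.subset_span ⟨i, rfl⟩, by rw [hy', hx]⟩
  obtain ⟨y, hyc, hy⟩ := Nat.find_spec hex
  have hmin := fun k => Nat.find_min hex (m := k)
  generalize Nat.find hex = n at y hyc hy hmin
  have hyc' : Ideal.span (Set.range y) ≤ c := Ideal.span_le.mpr (by rintro _ ⟨i, rfl⟩; exact hyc i)
  have hcm : c ≠ maximalIdeal R := fun h => hxc (h ▸ hxm)
  refine ⟨n, Fin.cons x y, ⟨?_, fun i => ?_⟩, ?_⟩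
  · rw [Fin.range_cons, Ideal.span_insert, hy]
  · intro hi
    induction i using Fin.cases with
    | zero =>
      refine hcm (le_antisymm (le_maximalIdeal_of_length_two hc) ?_)
      rw [← hi, Ideal.span_le]
      rintro _ ⟨j, hj, rfl⟩
      obtain ⟨j, rfl⟩ := Fin.exists_succ_eq.mpr hj
      rw [Fin.cons_succ]
      exact hyc j
    | succ j =>
      obtain ⟨n, rfl⟩ : ∃ k, n = k + 1 := ⟨n - 1, by have := j.2; omega⟩
      refine hmin n (Nat.lt_succ_self n) ⟨y ∘ j.succAbove, fun i => hyc _, le_antisymm ?_ ?_⟩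
      · rw [← hy]
        exact sup_le_sup_left (Ideal.span_mono (Set.range_comp_subset_range _ _)) _
      · rw [← hi, Ideal.span_le]
        rintro _ ⟨k, hk, rfl⟩
        induction k using Fin.cases with
        | zero => exact Ideal.mem_sup_left (Ideal.mem_span_singleton_self _)
        | succ k =>
          have hkj : k ≠ j := fun h => hk (congrArg Fin.succ h)
          obtain ⟨i, rfl⟩ := Fin.exists_succAbove_eq hkj
          exact Ideal.mem_sup_right (Ideal.subset_span ⟨i, rfl⟩)
  · simp only [Fin.cons_zero, Fin.cons_succ]
    refine le_antisymm (fun z hz => ?_) (sup_le ?_ hyc')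
    · have hzm := le_maximalIdeal_of_length_two hc hz
      rw [← hy] at hzm
      obtain ⟨_, h1, w, hw, rfl⟩ := Submodule.mem_sup.mp hzm
      obtain ⟨r, rfl⟩ := Ideal.mem_span_singleton'.mp h1
      -- As `x ∉ 𝔠`, the coefficient `r` is not a unit; expanding `r ∈ 𝔪` in the generators turns
      -- `rx` into a multiple of `x²` plus a combination of the `yᵢ`.
      have hrx : r * x ∈ c := (Submodule.add_mem_iff_left c (hyc' hw)).mp hz
      have hr : r ∈ maximalIdeal R := by
        rw [mem_maximalIdeal, mem_nonunits_iff]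
        exact fun hu => hxc ((Ideal.unit_mul_mem_iff_mem c hu).mp hrx)
      rw [← hy] at hr
      obtain ⟨_, h2, w', hw', rfl⟩ := Submodule.mem_sup.mp hr
      obtain ⟨s, rfl⟩ := Ideal.mem_span_singleton'.mp h2
      have h3 : (s * x + w') * x + w = s * x ^ 2 + (x * w' + w) := by ring
      rw [h3]
      exact Submodule.add_mem_sup (Ideal.mul_mem_left _ s (Ideal.mem_span_singleton_self _))
        (add_mem (Ideal.mul_mem_left _ x hw') hw)
    · rw [Ideal.span_singleton_le_iff_mem, pow_two]
      exact mul_mem_of_length_two hc hxm hxm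

end ColengthTwo

/-! ### Compatibility of the `R`- and `R/𝔠`-structures -/

section ScalarTower

open IsLocalRing

variable {R : Type u} [CommRing R] (F : Type v) [CommRing F] [Algebra R F] (I : Ideal R) (a : I)

instance : IsScalarTower R (R ⧸ conductorIdeal F I a) (KModR F I a) :=
  (isTorsionBySet_quotient (fracK_le_ringS I a) le_rfl).isScalarTower

instance : IsScalarTower R (R ⧸ conductorIdeal F I a) (SModR F I a) :=
  (isTorsionBySet_quotient le_rfl le_rfl).isScalarTower

instance : IsScalarTower R (R ⧸ conductorIdeal F I a) (SModK F I a) :=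
  (isTorsionBySet_quotient le_rfl (one_le_fracK I a)).isScalarTower

end ScalarTower

/-! ### The conductor and the equality `K² = S` -/

section AlmostGorenstein

open IsLocalRing

variable {R : Type u} [CommRing R] [IsLocalRing R] [IsNoetherianRing R]
  {F : Type v} [CommRing F] [Algebra R F] [IsFractionRing R F] {I : Ideal R} {a : I}

omit [IsNoetherianRing R] in
/-- The maximal ideal does not generate the unit ideal of a finite extension. -/
theorem one_notMem_maximalIdeal_smul [Module.Finite R (ringS F I a)] :
    (1 : F) ∉ maximalIdeal R • Subalgebra.toSubmodule (ringS F I a) := by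
  intro h
  have hfg : (Subalgebra.toSubmodule (ringS F I a)).FG := Module.Finite.iff_fg.mp ‹_›
  have hle : Subalgebra.toSubmodule (ringS F I a) ≤
      maximalIdeal R • Subalgebra.toSubmodule (ringS F I a) := by
    intro s hs
    -- Multiplying `1 ∈ 𝔪S` by `s` gives `s ∈ 𝔪S`; Nakayama then forces `S = 0`.
    have h1 : LinearMap.mulRight R s 1 ∈
        (maximalIdeal R • Subalgebra.toSubmodule (ringS F I a)).map (LinearMap.mulRight R s) :=
      ⟨1, h, rfl⟩
    rw [Submodule.map_smul'', LinearMap.mulRight_apply, one_mul] at h1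
    refine Submodule.smul_mono le_rfl ?_ h1
    rintro _ ⟨t, ht, rfl⟩
    exact (ringS F I a).mul_mem ht hs
  have h0 := Submodule.eq_bot_of_le_smul_of_le_jacobson_bot _ _ hfg hle
    (maximalIdeal_le_jacobson ⊥)
  have h1 : (1 : F) ∈ Subalgebra.toSubmodule (ringS F I a) := (ringS F I a).one_mem
  rw [h0, Submodule.mem_bot] at h1
  have : Nontrivial F := (IsFractionRing.injective R F).nontrivial
  exact one_ne_zero h1

/-- A fractional ideal between `R` and `S` needs one generator more than its quotient by `R`. -/
theorem mu_eq_mu_quotient_one_add_one [Module.Finite R (ringS F I a)] {N : Submodule R F}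
    (h1 : 1 ≤ N) (hN : N ≤ Subalgebra.toSubmodule (ringS F I a)) :
    mu R N = mu R (N ⧸ (1 : Submodule R F).submoduleOf N) + 1 := by
  have : IsNoetherian R (Subalgebra.toSubmodule (ringS F I a)) :=
    isNoetherian_of_isNoetherianRing_of_finite R (ringS F I a)
  have : IsNoetherian R N := isNoetherian_of_injective (Submodule.inclusion hN)
    (Submodule.inclusion_injective hN)
  refine mu_eq_mu_quotient_add_one (e := ⟨1, Submodule.one_le.mp h1⟩) (fun h => ?_)
    (Submodule.mkQ _) (Submodule.mkQ_surjective _) ?_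
  · have h2 := Submodule.mem_map_of_mem (f := N.subtype) h
    rw [Submodule.map_smul'', Submodule.map_top, Submodule.range_subtype] at h2
    exact one_notMem_maximalIdeal_smul (F := F) (I := I) (a := a) (Submodule.smul_mono le_rfl hN h2)
  · rw [Submodule.ker_mkQ]
    ext ⟨y, hy⟩
    rw [Submodule.mem_span_singleton]
    have h3 : (⟨y, hy⟩ : N) ∈ (1 : Submodule R F).submoduleOf N ↔ y ∈ (1 : Submodule R F) := Iff.rfl
    rw [h3, Submodule.mem_one]
    refine exists_congr fun r => ?_
    rw [Subtype.ext_iff, Algebra.algebraMap_eq_smul_one]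
    rfl

variable (ha : (a : R) ∈ nonZeroDivisors R) (hap : IsParameter (a : R)) (hI : IsCanonicalIdeal I)

include ha hap hI

/-- `R : S = K : S`. -/
theorem conductorSub_eq_fracK_div :
    conductorSub F I a = fracK F I a / Subalgebra.toSubmodule (ringS F I a) := by
  refine le_antisymm (fun y hy => ?_) (fun y hy => ?_)
  · rw [conductorSub, Submodule.mem_div_iff_forall_mul_mem] at hy
    rw [Submodule.mem_div_iff_forall_mul_mem]
    exact fun s hs => one_le_fracK I a (hy s hs)
  · rw [conductorSub, Submodule.mem_div_iff_forall_mul_mem]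
    rw [Submodule.mem_div_iff_forall_mul_mem] at hy
    intro s hs
    -- `ysK ⊆ yS ⊆ K` shows that `ys` lies in `K : K = R`.
    rw [← fracK_div_self (F := F) ha hap hI, Submodule.mem_div_iff_forall_mul_mem]
    intro k hk
    rw [mul_assoc]
    exact hy _ ((ringS F I a).mul_mem hs (fracK_le_ringS I a hk))

/-- By `R : S = K : S`, the conductor is the annihilator of `S/K`, the form in which it is used
below. -/
theorem mem_conductorIdeal_iff {r : R} :
    r ∈ conductorIdeal F I a ↔
      ∀ s ∈ Subalgebra.toSubmodule (ringS F I a), r • s ∈ fracK F I a := by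
  have h1 : r ∈ conductorIdeal F I a ↔ algebraMap R F r ∈ conductorSub F I a := Iff.rfl
  rw [h1, conductorSub_eq_fracK_div ha hap hI, Submodule.mem_div_iff_forall_mul_mem]
  simp only [Algebra.smul_def]

variable (h2 : Module.length R (SModK F I a) = 2)

include h2

/-- Otherwise `S/K` embeds in `(K:𝔪)/K`, whose length is one, not two. -/
theorem not_maximalIdeal_le_conductorIdeal : ¬ maximalIdeal R ≤ conductorIdeal F I a := by
  intro h
  have hle : Subalgebra.toSubmodule (ringS F I a) ≤
      fracK F I a / IsLocalization.coeSubmodule F (maximalIdeal R) := by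
    intro s hs
    rw [Submodule.mem_div_iff_forall_mul_mem]
    intro z hz
    obtain ⟨r, hr, rfl⟩ := (IsLocalization.mem_coeSubmodule F _).mp hz
    rw [mul_comm, ← Algebra.smul_def]
    exact (mem_conductorIdeal_iff ha hap hI).mp (h hr) s hs
  have h3 := Module.length_le_of_injective _ ((fracK F I a).mapQ_inclusion_injective hle)
  rw [length_fracK_colon_maximalIdeal ha hap hI, h2] at h3
  exact absurd h3 (by norm_num)

/-- `S/K` is cyclic. -/
theorem exists_span_singleton_eq_top : ∃ q : SModK F I a, Submodule.span R {q} = ⊤ := by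
  have hfl : IsFiniteLength R (SModK F I a) := Module.length_ne_top_iff.mp (by
    rw [h2]; exact ENat.ofNat_ne_top 2)
  obtain ⟨hN, hA⟩ := isFiniteLength_iff_isNoetherian_isArtinian.mp hfl
  -- Since `𝔪(S/K) ≠ 0`, the quotient of `S/K` by it has length below two, so one generator
  -- suffices.
  have hne : maximalIdeal R • (⊤ : Submodule R (SModK F I a)) ≠ ⊥ := by
    intro h
    refine not_maximalIdeal_le_conductorIdeal ha hap hI h2 fun r hr => ?_
    rw [mem_conductorIdeal_iff ha hap hI]
    intro s hs
    have h3 : r • (Submodule.Quotient.mk ⟨s, hs⟩ : SModK F I a) ∈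
        maximalIdeal R • (⊤ : Submodule R (SModK F I a)) :=
      Submodule.smul_mem_smul hr Submodule.mem_top
    rw [h, Submodule.mem_bot, ← Submodule.Quotient.mk_smul, Submodule.Quotient.mk_eq_zero] at h3
    exact h3
  have hlt := Submodule.length_quotient_lt _ hne
  rw [h2, ← mu_eq_length] at hlt
  have hlt' : mu R (SModK F I a) < 2 := by exact_mod_cast hlt
  have hnt : Nontrivial (SModK F I a) := Module.length_pos_iff.mp (by rw [h2]; norm_num)
  have hfg : (⊤ : Submodule R (SModK F I a)).FG := Module.Finite.fg_top
  have hmu0 : mu R (SModK F I a) ≠ 0 := by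
    intro h
    exact top_ne_bot ((Submodule.spanFinrank_eq_zero_iff_eq_bot hfg).mp h)
  have hmu : (⊤ : Submodule R (SModK F I a)).spanFinrank = 1 := by
    change mu R (SModK F I a) = 1
    omega
  obtain ⟨⟨q, hq⟩, -⟩ := (Submodule.spanFinrank_eq_one_iff _).mp hmu
  exact ⟨q, hq.symm⟩

/-- `S/K ≅ R/𝔠`. -/
theorem nonempty_SModK_equiv : Nonempty ((R ⧸ conductorIdeal F I a) ≃ₗ[R] SModK F I a) := by
  obtain ⟨q, hq⟩ := exists_span_singleton_eq_top ha hap hI h2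
  have hker : LinearMap.ker (LinearMap.toSpanSingleton R (SModK F I a) q) =
      conductorIdeal F I a := by
    ext r
    rw [LinearMap.mem_ker, LinearMap.toSpanSingleton_apply, mem_conductorIdeal_iff ha hap hI]
    constructor
    · intro hr s hs
      have h3 : (Submodule.Quotient.mk ⟨s, hs⟩ : SModK F I a) ∈ Submodule.span R {q} :=
        hq ▸ Submodule.mem_top
      obtain ⟨t, ht⟩ := Submodule.mem_span_singleton.mp h3
      have h4 : r • (Submodule.Quotient.mk ⟨s, hs⟩ : SModK F I a) = 0 := by
        rw [← ht, smul_comm, hr, smul_zero]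
      rw [← Submodule.Quotient.mk_smul, Submodule.Quotient.mk_eq_zero] at h4
      exact h4
    · intro hr
      obtain ⟨s, rfl⟩ := Submodule.Quotient.mk_surjective _ q
      rw [← Submodule.Quotient.mk_smul, Submodule.Quotient.mk_eq_zero]
      exact hr s s.2
  have hrange : LinearMap.range (LinearMap.toSpanSingleton R (SModK F I a) q) = ⊤ := by
    rw [LinearMap.range_toSpanSingleton, hq]
  exact ⟨(Submodule.quotEquivOfEq _ _ hker.symm).trans
    (LinearMap.quotKerEquivOfSurjective _ (LinearMap.range_eq_top.mp hrange))⟩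

theorem length_quotient_conductorIdeal : Module.length R (R ⧸ conductorIdeal F I a) = 2 := by
  obtain ⟨e⟩ := nonempty_SModK_equiv ha hap hI h2
  rw [e.length_eq, h2]

/-- `K² = S`. -/
theorem fracK_mul_self_eq {n : ℕ} (h : I ^ (n + 1) = Ideal.span {(a : R)} * I ^ n) :
    fracK F I a * fracK F I a = Subalgebra.toSubmodule (ringS F I a) := by
  have := finite_ringS (F := F) ha h
  have hK1 := one_le_fracK (F := F) I a
  have hle1 : fracK F I a ≤ fracK F I a * fracK F I a := by
    calc _ = 1 * fracK F I a := (one_mul _).symm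
      _ ≤ _ := mul_le_mul_left hK1 _
  have hle2 : fracK F I a * fracK F I a ≤ Subalgebra.toSubmodule (ringS F I a) :=
    Submodule.mul_le.mpr fun x hx y hy =>
      (ringS F I a).mul_mem (fracK_le_ringS I a hx) (fracK_le_ringS I a hy)
  by_contra hne
  have hadd := Module.length_quotient_submoduleOf_add hle1 hle2
  rw [h2] at hadd
  have hnt : Nontrivial (Subalgebra.toSubmodule (ringS F I a) ⧸
      (fracK F I a * fracK F I a).submoduleOf (Subalgebra.toSubmodule (ringS F I a))) := by
    rw [Submodule.Quotient.nontrivial_iff]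
    intro h
    exact hne (le_antisymm hle2 (Submodule.submoduleOf_eq_top.mp h))
  have hpos : 1 ≤ Module.length R (Subalgebra.toSubmodule (ringS F I a) ⧸
      (fracK F I a * fracK F I a).submoduleOf (Subalgebra.toSubmodule (ringS F I a))) :=
    Order.one_le_iff_pos.mpr Module.length_pos
  have hlen : Module.length R (↥(fracK F I a * fracK F I a) ⧸
      (fracK F I a).submoduleOf (fracK F I a * fracK F I a)) ≤ 1 := by
    refine (ENat.addLECancellable_of_ne_top ENat.one_ne_top).add_le_add_iff_right.mp ?_
    calc _ ≤ _ := add_le_add_right hpos _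
      _ = 2 := hadd.symm
      _ = 1 + 1 := one_add_one_eq_two.symm
  -- `ℓ(K²/K) ≤ 1` gives `𝔪K² ⊆ K`, that is, `𝔪K ⊆ K : K = R`.
  have hmK : ∀ r ∈ maximalIdeal R, ∀ k ∈ fracK F I a,
      ∃ t ∈ maximalIdeal R, algebraMap R F t = algebraMap R F r * k := by
    intro r hr k hk
    have h3 : algebraMap R F r * k ∈ fracK F I a / fracK F I a := by
      rw [Submodule.mem_div_iff_forall_mul_mem]
      intro k' hk'
      have h4 := smul_eq_zero_of_length_le_one hlen hr
        (Submodule.Quotient.mk ⟨k * k', Submodule.mul_mem_mul hk hk'⟩)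
      rw [← Submodule.Quotient.mk_smul, Submodule.Quotient.mk_eq_zero] at h4
      have h5 : r • (k * k') ∈ fracK F I a := h4
      rwa [Algebra.smul_def, ← mul_assoc] at h5
    rw [fracK_div_self ha hap hI, Submodule.mem_one] at h3
    obtain ⟨t, ht⟩ := h3
    refine ⟨t, ?_, ht⟩
    rw [mem_maximalIdeal, mem_nonunits_iff]
    rintro ⟨w, rfl⟩
    -- If `t = rk` were a unit, then `1 = r t⁻¹ k` would lie in `𝔪S`.
    refine one_notMem_maximalIdeal_smul (F := F) (I := I) (a := a) ?_
    have h6 : (1 : F) = r • (((w⁻¹ : Rˣ) : R) • k) := by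
      rw [smul_comm, Algebra.smul_def, Algebra.smul_def r, ← ht, ← map_mul, Units.inv_mul, map_one]
    rw [h6]
    exact Submodule.smul_mem_smul hr
      (Submodule.smul_mem _ _ (fracK_le_ringS I a hk))
  refine not_maximalIdeal_le_conductorIdeal ha hap hI h2 fun r hr => ?_
  -- Having `𝔪K ⊆ 𝔪`, not merely `𝔪K ⊆ R`, allows iteration to `𝔪Kʲ ⊆ 𝔪` for all `j`, hence `𝔪S ⊆
  -- R`.
  have hpow : ∀ k, ∀ y ∈ fracK F I a ^ k, ∀ r ∈ maximalIdeal R,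
      ∃ t ∈ maximalIdeal R, algebraMap R F t = algebraMap R F r * y := by
    intro k
    induction k with
    | zero =>
      intro y hy r hr
      rw [pow_zero, Submodule.mem_one] at hy
      obtain ⟨s, rfl⟩ := hy
      exact ⟨r * s, Ideal.mul_mem_right _ _ hr, map_mul _ _ _⟩
    | succ k ih =>
      intro y hy
      rw [pow_succ] at hy
      induction hy using Submodule.mul_induction_on' with
      | mem_mul_mem x hx z hz =>
        intro r hr
        obtain ⟨t, ht, htx⟩ := ih x hx r hr
        obtain ⟨s, hs, hsz⟩ := hmK t ht z hz
        exact ⟨s, hs, by rw [hsz, htx, mul_assoc]⟩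
      | add x _ z _ hx hz =>
        intro r hr
        obtain ⟨t, ht, htx⟩ := hx r hr
        obtain ⟨s, hs, hsz⟩ := hz r hr
        exact ⟨t + s, add_mem ht hs, by rw [map_add, htx, hsz, mul_add]⟩
  rw [mem_conductorIdeal_iff ha hap hI]
  intro s hs
  rw [toSubmodule_ringS_eq ha h] at hs
  obtain ⟨t, -, ht⟩ := hpow n s hs r hr
  rw [Algebra.smul_def, ← ht]
  exact hK1 (Submodule.mem_one.mpr ⟨t, rfl⟩)

/-- `R : S = R : K`. -/
theorem conductorSub_eq_one_div {n : ℕ} (h : I ^ (n + 1) = Ideal.span {(a : R)} * I ^ n) :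
    conductorSub F I a = 1 / fracK F I a := by
  refine le_antisymm (fun y hy => ?_) (fun y hy => ?_)
  · rw [conductorSub, Submodule.mem_div_iff_forall_mul_mem] at hy
    rw [Submodule.mem_div_iff_forall_mul_mem]
    exact fun k hk => hy k (fracK_le_ringS I a hk)
  -- With `S = K²`, the inclusion `yK ⊆ R` gives `yS = (yK)K ⊆ K`.
  · rw [conductorSub_eq_fracK_div ha hap hI, ← fracK_mul_self_eq ha hap hI h2 h]
    rw [Submodule.mem_div_iff_forall_mul_mem] at hy ⊢
    intro z hz
    induction hz using Submodule.mul_induction_on' with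
    | mem_mul_mem k hk k' hk' =>
      obtain ⟨r, hr⟩ := Submodule.mem_one.mp (hy k hk)
      rw [← mul_assoc, ← hr, ← Algebra.smul_def]
      exact Submodule.smul_mem _ _ hk'
    | add x _ z _ hx hz => rw [mul_add]; exact add_mem hx hz

end AlmostGorenstein

/-! ### Structure of `S/R` and `K/R` -/

section Structure

open IsLocalRing

variable {R : Type u} [CommRing R] {F : Type v} [CommRing F] [Algebra R F] {I : Ideal R} {a : I}

/-- If `S/K` is free of rank one then `S/R ≅ K/R ⊕ R/𝔠`. -/
theorem nonempty_SModR_equiv (e : (R ⧸ conductorIdeal F I a) ≃ₗ[R] SModK F I a) :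
    Nonempty (SModR F I a ≃ₗ[R] (KModR F I a × (R ⧸ conductorIdeal F I a))) := by
  let c := conductorIdeal F I a
  have hKS := fracK_le_ringS (F := F) I a
  let i : KModR F I a →ₗ[R] SModR F I a :=
    Submodule.mapQ _ _ (Submodule.inclusion hKS) (Submodule.inclusion_submoduleOf_le _ hKS)
  let g : SModR F I a →ₗ[R] SModK F I a :=
    Submodule.factor (Submodule.comap_mono (one_le_fracK I a))
  have hi : Function.Injective i := Submodule.mapQ_inclusion_injective _ hKS
  have hg : Function.Surjective g := Submodule.factor_surjective _
  have hex : Function.Exact i g := Submodule.exact_mapQ_inclusion_factor (one_le_fracK I a) hKS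
  -- A lift `s` of the generator of `S/K`. It is killed by `𝔠`, so `1 ↦ s` defines a map `j` on
  -- `R/𝔠`, which splits `g`.
  obtain ⟨s, hs⟩ := hg (e (Submodule.Quotient.mk 1))
  have htors : Module.IsTorsionBySet R (SModR F I a) c := isTorsionBySet_quotient le_rfl le_rfl
  let j : (R ⧸ c) →ₗ[R] SModR F I a :=
    Submodule.liftQ c (LinearMap.toSpanSingleton R _ s) fun r hr =>
      @htors s ⟨r, hr⟩
  have hj : ∀ r : R, j (Submodule.Quotient.mk r) = r • s := fun _ => rfl
  have hgj : ∀ q, g (j q) = e q := by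
    intro q
    obtain ⟨r, rfl⟩ := Submodule.Quotient.mk_surjective _ q
    rw [hj, map_smul, hs, ← map_smul, ← Submodule.Quotient.mk_smul, smul_eq_mul, mul_one]
  refine ⟨(LinearEquiv.ofBijective (i.coprod j) ⟨?_, fun y => ?_⟩).symm⟩
  · rw [injective_iff_map_eq_zero]
    rintro ⟨k, q⟩ h
    rw [LinearMap.coprod_apply] at h
    have h1 : e q = 0 := by
      rw [← hgj, eq_neg_of_add_eq_zero_right h, map_neg, hex.apply_apply_eq_zero, neg_zero]
    have h2 : q = 0 := e.map_eq_zero_iff.mp h1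
    rw [h2, map_zero, add_zero] at h
    have h3 : k = 0 := hi (h.trans (map_zero i).symm)
    rw [h2, h3]
    rfl
  · have h1 : g (y - j (e.symm (g y))) = 0 := by
      rw [map_sub, hgj, LinearEquiv.apply_symm_apply, sub_self]
    obtain ⟨k, hk⟩ := (hex _).mp h1
    exact ⟨(k, e.symm (g y)), by rw [LinearMap.coprod_apply, hk, sub_add_cancel]⟩

/-- The structure of `K/R` when `R/𝔠` has length two. -/
theorem exists_KModR_equiv [IsLocalRing R] [IsNoetherianRing R] [Module.Finite R (fracK F I a)]
    (hc : Module.length R (R ⧸ conductorIdeal F I a) = 2) :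
    ∃ l m : ℕ, Nonempty (KModR F I a ≃ₗ[R ⧸ conductorIdeal F I a]
      ((Fin l → R ⧸ conductorIdeal F I a) ×
        (Fin m → ResidueModule (conductorIdeal F I a)))) := by
  let c := conductorIdeal F I a
  obtain ⟨x, hxm, hxc, hx⟩ := exists_span_sup_eq_of_length_two hc
  have hcm := le_maximalIdeal_of_length_two hc
  let p : Ideal (R ⧸ c) := (maximalIdeal R).map (Ideal.Quotient.mk c)
  have hp : p.IsMaximal := by
    refine (Ideal.map_eq_top_or_isMaximal_of_surjective _ Ideal.Quotient.mk_surjective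
      (maximalIdeal.isMaximal R)).resolve_left fun h => ?_
    have h1 := congrArg (Ideal.comap (Ideal.Quotient.mk c)) h
    rw [Ideal.comap_map_of_surjective' _ Ideal.Quotient.mk_surjective, Ideal.mk_ker,
      sup_eq_left.mpr hcm, Ideal.comap_top] at h1
    exact (maximalIdeal.isMaximal R).ne_top h1
  have hpx : p = Ideal.span {Ideal.Quotient.mk c x} := by
    change Ideal.map _ _ = _
    rw [← hx, Ideal.map_sup, Ideal.map_quotient_self, sup_bot_eq, Ideal.map_span,
      Set.image_singleton]
  have : IsNoetherian (R ⧸ c) (KModR F I a) := isNoetherian_of_tower R inferInstance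
  refine Module.exists_equiv_prod_pi_of_sq_eq_zero (p := p) hpx ?_ ?_
  · rw [← map_mul, Ideal.Quotient.eq_zero_iff_mem]
    exact mul_mem_of_length_two hc hxm hxm
  · rwa [Ne, Ideal.Quotient.eq_zero_iff_mem]

variable [IsLocalRing R]

theorem nonempty_residueModule_equiv {c : Ideal R} (hc : c ≤ maximalIdeal R) :
    Nonempty (ResidueModule c ≃ₗ[R] (R ⧸ maximalIdeal R)) :=
  ⟨(DoubleQuot.quotQuotEquivQuotOfLEₐ R hc).toLinearEquiv⟩

theorem mu_pi_prod_pi {c : Ideal R} (hc : c ≤ maximalIdeal R) (l m : ℕ) :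
    mu R ((Fin l → R ⧸ c) × (Fin m → ResidueModule c)) = l + m := by
  obtain ⟨e⟩ := nonempty_residueModule_equiv hc
  have hm := (maximalIdeal.isMaximal R).ne_top
  have hc' : c ≠ ⊤ := fun h => hm (top_le_iff.mp (h ▸ hc))
  rw [mu_congr ((LinearEquiv.refl R _).prodCongr (LinearEquiv.piCongrRight fun _ : Fin m => e)),
    mu_prod_pi_quotient hm,
    mu_congr (LinearEquiv.uniqueProd (R := R) (M₂ := PUnit) (M := Fin l → R ⧸ c)).symm,
    mu_prod_pi_quotient hc']
  have h0 : mu R PUnit = 0 := by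
    rw [mu, Subsingleton.elim (⊤ : Submodule R PUnit) ⊥, Submodule.spanFinrank_bot]
  rw [h0, zero_add]

theorem length_pi_prod_pi {c : Ideal R} (hc : Module.length R (R ⧸ c) = 2) (l m : ℕ) :
    Module.length R ((Fin l → R ⧸ c) × (Fin m → ResidueModule c)) = ((2 * l + m : ℕ) : ℕ∞) := by
  obtain ⟨e⟩ := nonempty_residueModule_equiv (le_maximalIdeal_of_length_two hc)
  have := isSimpleModule_residue (R := R)
  rw [Module.length_prod, Module.length_pi, Module.length_pi, hc, e.length_eq,
    Module.length_eq_one R (R ⧸ maximalIdeal R)]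
  simp [mul_comm]

end Structure

end TwoAGL

/-! ### The main theorem -/

theorem proposition2p7 {R : Type u} [CommRing R] [IsLocalRing R] [IsNoetherianRing R]
    (F : Type v) [CommRing F] [Algebra R F] [IsFractionRing R F]
    (hCM : TwoAGL.IsMaximalCohenMacaulay R R) (hdim : ringKrullDim R = 1)
    (I : Ideal R) (hI : TwoAGL.IsCanonicalIdeal I)
    (a : I) (ha : TwoAGL.IsParameter (a : R)) (hred : TwoAGL.IsReduction (Ideal.span {(a : R)}) I)
    (h2 : TwoAGL.Is2AGL I a) :
    -- (1) `𝔠 = K : S = R : K`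
    (TwoAGL.conductorSub F I a
        = TwoAGL.fracK F I a / Subalgebra.toSubmodule (TwoAGL.ringS F I a) ∧
      TwoAGL.conductorSub F I a = 1 / TwoAGL.fracK F I a) ∧
    -- (2) `ℓ_R(R/𝔠) = 2`, and the shape of `𝔠`
    (Module.length R (R ⧸ TwoAGL.conductorIdeal F I a) = 2 ∧
      ∃ (n : ℕ) (x : Fin (n + 1) → R),
        TwoAGL.IsMinimalGenerators (IsLocalRing.maximalIdeal R) x ∧
        TwoAGL.conductorIdeal F I a =
          Ideal.span {x 0 ^ 2} ⊔ Ideal.span (Set.range fun i : Fin n => x i.succ)) ∧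
    -- (3) `S/K ≅ R/𝔠` and `S/R ≅ K/R ⊕ R/𝔠` as `R/𝔠`-modules
    (Nonempty (TwoAGL.SModK F I a ≃ₗ[R ⧸ TwoAGL.conductorIdeal F I a]
        (R ⧸ TwoAGL.conductorIdeal F I a)) ∧
      Nonempty (TwoAGL.SModR F I a ≃ₗ[R ⧸ TwoAGL.conductorIdeal F I a]
        (TwoAGL.KModR F I a × (R ⧸ TwoAGL.conductorIdeal F I a)))) ∧
    -- (4) the structure of `K/R`
    ((∃ l m : ℕ, 0 < l ∧ ((l + m : ℕ) : ℕ∞) + 1 = TwoAGL.cmType R R ∧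
        Nonempty (TwoAGL.KModR F I a ≃ₗ[R ⧸ TwoAGL.conductorIdeal F I a]
          ((Fin l → R ⧸ TwoAGL.conductorIdeal F I a) ×
            (Fin m → TwoAGL.ResidueModule (TwoAGL.conductorIdeal F I a)))) ∧
        Module.length R (TwoAGL.KModR F I a) = ((2 * l + m : ℕ) : ℕ∞)) ∧
      (Module.Free (R ⧸ TwoAGL.conductorIdeal F I a) (TwoAGL.KModR F I a) ↔
        Module.length R (TwoAGL.KModR F I a) = 2 * (TwoAGL.cmType R R - 1))) ∧
    -- (5) `μ_R(S/R) = r`, equivalently `μ_R(S) = r + 1`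
    (Module.Finite R (TwoAGL.ringS F I a) ∧
      (TwoAGL.mu R (TwoAGL.SModR F I a) : ℕ∞) = TwoAGL.cmType R R ∧
      (TwoAGL.mu R (TwoAGL.ringS F I a) : ℕ∞) = TwoAGL.cmType R R + 1) := by

  classical
  obtain ⟨-, n, hn⟩ := hred
  have ha0 := ha.mem_nonZeroDivisors hCM hdim
  have hlen : Module.length R (TwoAGL.SModK F I a) = 2 := by
    rw [← TwoAGL.length_sallyComponent ha0 hn,
      ← TwoAGL.sallyRank_eq_length_component I a ha0 hn]
    exact h2
  have hS := TwoAGL.finite_ringS (F := F) ha0 hn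
  have hK := TwoAGL.finite_fracK (F := F) ha0
  have hc := TwoAGL.length_quotient_conductorIdeal ha0 ha hI hlen
  have hcm := TwoAGL.le_maximalIdeal_of_length_two hc
  have hctop : TwoAGL.conductorIdeal F I a ≠ ⊤ := fun h =>
    (IsLocalRing.maximalIdeal.isMaximal R).ne_top (top_le_iff.mp (h ▸ hcm))
  have hmk : Function.Surjective (algebraMap R (R ⧸ TwoAGL.conductorIdeal F I a)) :=
    Ideal.Quotient.mk_surjective
  obtain ⟨e₁⟩ := TwoAGL.nonempty_SModK_equiv ha0 ha hI hlen
  obtain ⟨e₂⟩ := TwoAGL.nonempty_SModR_equiv e₁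
  obtain ⟨l, m, ⟨e₃⟩⟩ := TwoAGL.exists_KModR_equiv (F := F) (I := I) (a := a) hc
  have hmuK : TwoAGL.mu R (TwoAGL.KModR F I a) = l + m := by
    rw [TwoAGL.mu_congr (e₃.restrictScalars R), TwoAGL.mu_pi_prod_pi hcm]
  have hlenK : Module.length R (TwoAGL.KModR F I a) = ((2 * l + m : ℕ) : ℕ∞) := by
    rw [(e₃.restrictScalars R).length_eq, TwoAGL.length_pi_prod_pi hc]
  have hr : TwoAGL.cmType R R = ((l + m + 1 : ℕ) : ℕ∞) := by
    rw [TwoAGL.cmType_self_eq_mu_fracK (F := F) ha0 ha hI,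
      TwoAGL.mu_eq_mu_quotient_one_add_one (TwoAGL.one_le_fracK I a)
        (TwoAGL.fracK_le_ringS I a), hmuK]
  have hmuS : TwoAGL.mu R (TwoAGL.SModR F I a) = l + m + 1 := by
    rw [TwoAGL.mu_congr e₂, TwoAGL.mu_prod_quotient hctop, hmuK]
  have hcR := TwoAGL.conductorSub_eq_one_div ha0 ha hI hlen hn
  -- If `l = 0`, then `𝔪` kills `K/R`, so `𝔪 ⊆ R : K = 𝔠`, which is excluded.
  have hl : 0 < l := by
    rw [Nat.pos_iff_ne_zero]
    rintro rfl
    refine TwoAGL.not_maximalIdeal_le_conductorIdeal ha0 ha hI hlen fun r hr => ?_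
    change algebraMap R F r ∈ TwoAGL.conductorSub F I a
    rw [hcR, Submodule.mem_div_iff_forall_mul_mem]
    intro k hk
    have h0 : r • (Submodule.Quotient.mk ⟨k, hk⟩ : TwoAGL.KModR F I a) = 0 := by
      apply (e₃.restrictScalars R).injective
      rw [map_smul, map_zero]
      refine Prod.ext (Subsingleton.elim _ _) (funext fun i => ?_)
      obtain ⟨q, hq⟩ := Ideal.Quotient.mk_surjective (((e₃.restrictScalars R)
        (Submodule.Quotient.mk ⟨k, hk⟩ : TwoAGL.KModR F I a)).2 i)
      change r • ((e₃.restrictScalars R)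
        (Submodule.Quotient.mk ⟨k, hk⟩ : TwoAGL.KModR F I a)).2 i = 0
      rw [← hq, Algebra.smul_def]
      exact Ideal.Quotient.eq_zero_iff_mem.mpr
        (Ideal.mul_mem_right q _ (Ideal.mem_map_of_mem _ hr))
    rw [← Submodule.Quotient.mk_smul, Submodule.Quotient.mk_eq_zero] at h0
    rw [← Algebra.smul_def]
    exact h0
  refine ⟨⟨TwoAGL.conductorSub_eq_fracK_div ha0 ha hI, hcR⟩,
    ⟨hc, TwoAGL.exists_isMinimalGenerators_of_length_two hc⟩,
    ⟨⟨(e₁.extendScalarsOfSurjective hmk).symm⟩, ⟨e₂.extendScalarsOfSurjective hmk⟩⟩,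
    ⟨⟨l, m, hl, ?_, ⟨e₃⟩, hlenK⟩, ?_⟩, hS, ?_, ?_⟩
  · rw [hr]; norm_cast
  -- The truncated subtraction is harmless, as `r = l + m + 1 ≥ 1`.
  · have hr' : 2 * (TwoAGL.cmType R R - 1) = ((2 * (l + m) : ℕ) : ℕ∞) := by
      rw [hr]; norm_cast
    rw [hr', hlenK, Nat.cast_inj]
    constructor
    · intro hfree
      have hnt : Nontrivial (R ⧸ TwoAGL.conductorIdeal F I a) :=
        Ideal.Quotient.nontrivial_iff.mpr hctop
      have hfin : Module.Finite (R ⧸ TwoAGL.conductorIdeal F I a) (TwoAGL.KModR F I a) :=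
        Module.Finite.of_restrictScalars_finite R _ _
      -- A free `K/R` of rank `f` also has the shape `(f, 0)`. Counting generators gives `f = l +
      -- m`, and counting lengths gives `2f = 2l + m`.
      let e₄ := ((Module.finBasis (R ⧸ TwoAGL.conductorIdeal F I a)
        (TwoAGL.KModR F I a)).equivFun.trans
          (LinearEquiv.prodUnique (R := R ⧸ TwoAGL.conductorIdeal F I a)
            (M₂ := Fin 0 → TwoAGL.ResidueModule (TwoAGL.conductorIdeal F I a))).symm).restrictScalars R
      have h3 := TwoAGL.mu_congr e₄
      have h4 := e₄.length_eq
      rw [TwoAGL.mu_pi_prod_pi hcm, hmuK] at h3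
      rw [TwoAGL.length_pi_prod_pi hc, hlenK, Nat.cast_inj] at h4
      omega
    · intro h
      obtain rfl : m = 0 := by omega
      exact Module.Free.of_equiv (e₃.trans LinearEquiv.prodUnique).symm
  · rw [hmuS, hr]
  · have h3 := TwoAGL.mu_eq_mu_quotient_one_add_one (F := F) (I := I) (a := a)
      ((TwoAGL.one_le_fracK I a).trans (TwoAGL.fracK_le_ringS I a)) le_rfl
    rw [TwoAGL.mu_congr (Subalgebra.toSubmoduleEquiv (TwoAGL.ringS F I a))] at h3
    rw [h3, hmuS, hr]
    norm_cast
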